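/- Let $\ell\in\{[0,\infty),(-\infty,\infty)\}$ and let $f:\ell\to X$ be a continuous bijection onto a metrizable space $X$. A continuum is a non-empty connected compact metrizable space, and a subcontinuum is a subset which is a continuum. A continuum is indecomposable if it is not the union of two proper subcontinua. The composant of a point $x$ in a continuum $Y$ is the union of all proper subcontinua of $Y$ that contain $x$. An arc is a homeomorphic copy of $[0,1]$. Let $K(X)$ be the set of non-empty compact subsets of $X$ with the Vietoris topology. Overlines denote closures in $X$. Then $X$ is homeomorphic to a composant (of some point) of some indecomposable continuum if and only if (1) $f$ is recurrent: for every $n\in\{0,1,2,\dots\}$, $\overline{f[\ell\cap[n,\infty)]}=X$ or $\overline{f[\ell\cap(-\infty,-n]]}=X$; and (2) for every sequence of arcs $(A_n)_{n\ge 0}$ in $X$ for which there are points $x_n\in A_n$ such that $(x_n)$ converges in $X$, the set $\overline{\bigcup_n A_n}$ is compact or equal to $X$. Moreover, condition (2) is equivalent to: (2') for every sequence of arcs $(A_n)_{n\ge 0}$ in $X$ for which there are points $x_n\in A_n$ such that $(x_n)$ converges in $X$, if $\overline{\bigcup_n A_n}\neq X$ then some subsequence of $(A_n)$ converges in $K(X)$.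 -/

import Mathlib

open Set Filter Topology TopologicalSpace

universe u v

/-- A continuum: a (non-empty) connected compact metrizable space. -/
def IsContinuum (Y : Type*) [TopologicalSpace Y] : Prop :=
  ConnectedSpace Y ∧ CompactSpace Y ∧ MetrizableSpace Y

/-- A subcontinuum of `Y` (used for metrizable `Y`): a non-empty connected compact subset. -/
def IsSubcontinuum {Y : Type*} [TopologicalSpace Y] (K : Set Y) : Prop :=
  IsConnected K ∧ IsCompact K

/-- An indecomposable continuum: not the union of two proper subcontinua. -/
def IsIndecomposableContinuum (Y : Type*) [TopologicalSpace Y] : Prop :=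
  IsContinuum Y ∧
    ¬ ∃ H K : Set Y, IsSubcontinuum H ∧ IsSubcontinuum K ∧ H ≠ univ ∧ K ≠ univ ∧ H ∪ K = univ

/-- The composant of `x` in `Y`: the union of all proper subcontinua of `Y` containing `x`. -/
def composant {Y : Type*} [TopologicalSpace Y] (x : Y) : Set Y :=
  ⋃₀ {K : Set Y | IsSubcontinuum K ∧ K ≠ univ ∧ x ∈ K}

/-- `P` is a composant of `Y`. -/
def IsComposant {Y : Type*} [TopologicalSpace Y] (P : Set Y) : Prop :=
  ∃ x ∈ P, P = composant x

/-- `X` is (homeomorphic to) a composant of some indecomposable continuum. -/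
def IsIndecomposableComposant (X : Type u) [TopologicalSpace X] : Prop :=
  ∃ (Y : Type v) (_ : TopologicalSpace Y) (e : X → Y),
    IsIndecomposableContinuum Y ∧ IsEmbedding e ∧ IsComposant (range e)

/-- An arc: a homeomorphic copy of `[0, 1]`. -/
def IsArc {X : Type*} [TopologicalSpace X] (A : Set X) : Prop :=
  Nonempty (A ≃ₜ Icc (0 : ℝ) 1)

/-- Recurrence of a mapping of `ℓ = [0, ∞)` or `ℓ = ℝ`: for each `n`, the image of the final segment
`ℓ ∩ [n, ∞)` or the image of the initial segment `ℓ ∩ (-∞, -n]` is dense. -/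
def IsRecurrent {X : Type*} [TopologicalSpace X] {ℓ : Set ℝ} (f : ℓ → X) : Prop :=
  ∀ n : ℕ, closure (f '' {t : ℓ | (n : ℝ) ≤ (t : ℝ)}) = univ ∨
    closure (f '' {t : ℓ | (t : ℝ) ≤ -(n : ℝ)}) = univ

/-- Some selection of points `x n ∈ A n` converges in `X`. -/
def HasConvergentSelection {X : Type*} [TopologicalSpace X] (A : ℕ → NonemptyCompacts X) : Prop :=
  ∃ (x : ℕ → X) (p : X), (∀ n, x n ∈ A n) ∧ Tendsto x atTop (𝓝 p)

/-- For every sequence of arcs in `X` with a convergent selection, the closure of the union is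
compact or all of `X`. -/
def ArcClosureCondition (X : Type*) [TopologicalSpace X] : Prop :=
  ∀ A : ℕ → NonemptyCompacts X, (∀ n, IsArc (A n : Set X)) → HasConvergentSelection A →
    IsCompact (closure (⋃ n, (A n : Set X))) ∨ closure (⋃ n, (A n : Set X)) = univ

/-- Every sequence of arcs in `X` with a convergent selection and non-dense union has a subsequence
converging in the hyperspace of non-empty compact subsets of `X` (Mathlib's topology on
`NonemptyCompacts X` is the Vietoris topology). -/
def ArcSubsequenceCondition (X : Type*) [TopologicalSpace X] : Prop :=
  ∀ A : ℕ → NonemptyCompacts X, (∀ n, IsArc (A n : Set X)) → HasConvergentSelection A →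
    closure (⋃ n, (A n : Set X)) ≠ univ →
      ∃ (φ : ℕ → ℕ) (K : NonemptyCompacts X), StrictMono φ ∧
        Tendsto (fun k => A (φ k)) atTop (𝓝 K)

/-! Sufficiency amounts to finding a metrizable compactification `Y` of `X` in which every proper
subcontinuum meeting `X` lies in `X`. Given such a `Y`, if `Y` were the union of two proper
subcontinua, each would contain the non-empty open complement of the other, hence meet the dense set
`X` and lie in it. Then `X` would be compact, whereas Baire's theorem and recurrence show that
compact subsets of `X` have empty interior. Since arcs join the points of `X`, it is a composant.

To build `Y`, remove a non-empty basic open set `U` from `X`. If both ends of the line return to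
`U`, the parameters of `S = X \ U` have gaps arbitrarily far out, and by Sierpiński's theorem every
continuum in `S` is an arc or a point. The arc condition makes the decomposition of `S` into arc
components upper semicontinuous with compact classes. Its quotient is a countable union of compact
totally separated pieces, so the countable sum theorem gives each class arbitrarily small clopen
neighbourhoods in `S`. Countably many clopen sets suffice for all basic `U`, and `Y` is chosen so
that the closures of each of them and of its complement in `S` are disjoint. A proper subcontinuum
of `Y` that meets `X` misses some `U`; no such clopen set can split it, so it is squeezed into a
single class.

If only one end of the line is recurrent, the closure `L` of the other half is compact by the arc
condition. It has empty interior, so it suffices to take `U` disjoint from `L`, and all classes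
touching `L` are merged into one.

Necessity: a limit of arcs with a convergent selection is a continuum meeting the composant, and if
proper it stays inside. Non-density of both ends would split `Y` into two proper subcontinua.
Conditions (2) and (2') are linked by compactness of the hyperspace of a compact metrizable space.
-/

/-! ### Continua in Hausdorff and normal spaces -/

/-- Boundary bumping: a point of a continuum `T` is joined inside a closed set `E` not containing
`T` to the frontier of `E`. -/
theorem IsPreconnected.exists_isConnected_inter_closure_compl_nonempty {X : Type*}
    [TopologicalSpace X] [T2Space X] {T E : Set X} {x : X} (hT : IsPreconnected T)
    (hTc : IsCompact T) (hxT : x ∈ T) (hE : IsClosed E) (hxE : x ∈ E) (hTE : ¬ T ⊆ E) :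
    ∃ C ⊆ T ∩ E, IsCompact C ∧ IsConnected C ∧ x ∈ C ∧ (C ∩ closure Eᶜ).Nonempty := by
  have hQ : IsCompact (T ∩ E) := hTc.inter_right hE
  have : CompactSpace ↥(T ∩ E) := isCompact_iff_compactSpace.1 hQ
  let x' : ↥(T ∩ E) := ⟨x, hxT, hxE⟩
  refine ⟨Subtype.val '' connectedComponent x', ?_, ?_, ?_, ?_, ?_⟩
  · rintro _ ⟨y, -, rfl⟩
    exact y.2
  · exact isClosed_connectedComponent.isCompact.image continuous_subtype_val
  · exact isConnected_connectedComponent.image _ continuous_subtype_val.continuousOn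
  · exact ⟨x', mem_connectedComponent, rfl⟩
  by_contra hne
  have hO : IsOpen ((Subtype.val : ↥(T ∩ E) → X) ⁻¹' (closure Eᶜ)ᶜ) :=
    isClosed_closure.isOpen_compl.preimage continuous_subtype_val
  have hsub : connectedComponent x' ⊆ Subtype.val ⁻¹' (closure Eᶜ)ᶜ := by
    intro y hy hyE
    exact hne ⟨y, ⟨y, hy, rfl⟩, hyE⟩
  -- In a compact Hausdorff space components are intersections of clopen sets. A clopen `D` missing
  -- `closure Eᶜ` then splits `T` into the disjoint closed parts `D` and `closure Eᶜ ∪ Dᶜ`.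
  obtain ⟨D, hDc, hxD, hDO⟩ : ∃ D : Set ↥(T ∩ E), IsClopen D ∧ x' ∈ D ∧
      D ⊆ Subtype.val ⁻¹' (closure Eᶜ)ᶜ := by
    rw [connectedComponent_eq_iInter_isClopen] at hsub
    have : Nonempty { s : Set ↥(T ∩ E) // IsClopen s ∧ x' ∈ s } :=
      ⟨⟨univ, isClopen_univ, mem_univ _⟩⟩
    obtain ⟨⟨D, hD⟩, hD'⟩ := exists_subset_nhds_of_compactSpace
      (V := fun s : { s : Set ↥(T ∩ E) // IsClopen s ∧ x' ∈ s } => (s : Set ↥(T ∩ E)))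
      (fun s t => ⟨⟨s.1 ∩ t.1, s.2.1.inter t.2.1, s.2.2, t.2.2⟩, inter_subset_left,
        inter_subset_right⟩) (fun s => s.2.1.1) (fun y hy => hO.mem_nhds (hsub hy))
    exact ⟨D, hD.1, hD.2, hD'⟩
  obtain ⟨t, htT, htE⟩ := not_subset.1 hTE
  have h1 : IsClosed (Subtype.val '' D) :=
    (hDc.1.isCompact.image continuous_subtype_val).isClosed
  have h2 : IsClosed (Subtype.val '' Dᶜ) :=
    (hDc.2.isClosed_compl.isCompact.image continuous_subtype_val).isClosed
  obtain ⟨z, -, ⟨d, hd, rfl⟩, hz⟩ := isPreconnected_closed_iff.1 hT (Subtype.val '' D)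
    (closure Eᶜ ∪ Subtype.val '' Dᶜ) h1 (isClosed_closure.union h2)
    (by
      intro z hz
      by_cases hzE : z ∈ E
      · by_cases hzD : (⟨z, hz, hzE⟩ : ↥(T ∩ E)) ∈ D
        · exact Or.inl ⟨_, hzD, rfl⟩
        · exact Or.inr (Or.inr ⟨_, hzD, rfl⟩)
      · exact Or.inr (Or.inl (subset_closure hzE)))
    ⟨x, hxT, x', hxD, rfl⟩ ⟨t, htT, Or.inl (subset_closure htE)⟩
  rcases hz with hz | ⟨d', hd', hdd⟩
  · exact hDO hd hz
  · exact hd' (Subtype.val_injective hdd ▸ hd)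

/-- Sierpiński's theorem: a continuum covered by countably many pairwise disjoint closed sets
lies in one of them. -/
theorem IsConnected.exists_subset_of_pairwise_disjoint_isClosed {X : Type*} [TopologicalSpace X]
    [T4Space X] {T : Set X} (hT : IsConnected T) (hTc : IsCompact T) {P : ℕ → Set X}
    (hP : ∀ n, IsClosed (P n)) (hd : Pairwise (fun i j => Disjoint (P i) (P j)))
    (hTP : T ⊆ ⋃ n, P n) : ∃ n, T ⊆ P n := by
  by_contra! hcon
  -- Shrink `A` so as to avoid `P n`: take `q ∈ A` in another `P j` and a neighbourhood `G` of `P j`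
  -- whose closure misses `P n`. The bumped continuum in `closure G` contains `q` and a point
  -- outside `G`, so no single `P m` contains it. The nested intersection finally misses every `P
  -- n`.
  have step : ∀ (n : ℕ) (A : {A : Set X // IsCompact A ∧ IsConnected A ∧ A ⊆ T ∧ ∀ m, ¬ A ⊆ P m}),
      ∃ B : {A : Set X // IsCompact A ∧ IsConnected A ∧ A ⊆ T ∧ ∀ m, ¬ A ⊆ P m},
        B.1 ⊆ A.1 ∧ Disjoint B.1 (P n) := by
    rintro n ⟨A, hAc, hA, hAT, hAP⟩
    by_cases hdis : Disjoint A (P n)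
    · exact ⟨⟨A, hAc, hA, hAT, hAP⟩, Subset.rfl, hdis⟩
    obtain ⟨q, hqA, hqn⟩ := not_subset.1 (hAP n)
    obtain ⟨j, hqj⟩ := mem_iUnion.1 (hTP (hAT hqA))
    have hjn : j ≠ n := by rintro rfl; exact hqn hqj
    obtain ⟨G, hG, hPG, hGn⟩ := normal_exists_closure_subset (hP j) (hP n).isOpen_compl
      (subset_compl_iff_disjoint_right.2 (hd hjn))
    have hAG : ¬ A ⊆ closure G := fun h =>
      hdis (disjoint_left.2 fun a ha han => hGn (h ha) han)
    obtain ⟨C, hCA, hCc, hC, hqC, w, hwC, hw⟩ :=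
      hA.isPreconnected.exists_isConnected_inter_closure_compl_nonempty hAc hqA isClosed_closure
        (subset_closure (hPG hqj)) hAG
    have hwG : w ∉ G := by
      have : closure (closure G)ᶜ ⊆ Gᶜ :=
        closure_minimal (compl_subset_compl.2 subset_closure) hG.isClosed_compl
      exact this hw
    refine ⟨⟨C, hCc, hC, fun c hc => hAT (hCA hc).1, fun m hm => ?_⟩, fun c hc => (hCA hc).1,
      disjoint_left.2 fun c hc hcn => hGn (hCA hc).2 hcn⟩
    by_cases hmj : m = j
    · subst hmj
      exact hwG (hPG (hm hwC))
    · exact disjoint_left.1 (hd hmj) (hm hqC) hqj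
  choose B hB hB' using step
  let K : ℕ → {A : Set X // IsCompact A ∧ IsConnected A ∧ A ⊆ T ∧ ∀ m, ¬ A ⊆ P m} :=
    fun n => Nat.rec ⟨T, hTc, hT, Subset.rfl, hcon⟩ (fun n A => B n A) n
  have hne : (⋂ n, (K n).1).Nonempty :=
    IsCompact.nonempty_iInter_of_sequence_nonempty_isCompact_isClosed (fun n => (K n).1)
      (fun n => hB n (K n)) (fun n => (K n).2.2.1.nonempty) (K 0).2.1
      (fun n => (K n).2.1.isClosed)
  obtain ⟨z, hz⟩ := hne
  rw [mem_iInter] at hz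
  obtain ⟨n, hn⟩ := mem_iUnion.1 (hTP (hz 0))
  exact disjoint_left.1 (hB' n (K n)) (hz (n + 1)) hn

/-- Limit points of a sequence of connected subsets of a compact set, one of which is a limit,
lie in a common continuum. -/
theorem IsCompact.exists_isConnected_of_tendsto {X : Type*} [TopologicalSpace X]
    [T2Space X] {Q : Set X} (hQ : IsCompact Q) {A : ℕ → Set X} (hA : ∀ n, IsPreconnected (A n))
    (hAQ : ∀ n, A n ⊆ Q) {a b : ℕ → X} (ha : ∀ n, a n ∈ A n) (hb : ∀ n, b n ∈ A n) {x y : X}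
    (hx : Tendsto a atTop (𝓝 x)) (hy : Tendsto b atTop (𝓝 y)) :
    ∃ T ⊆ closure (⋃ n, A n), IsCompact T ∧ IsConnected T ∧ x ∈ T ∧ y ∈ T := by
  let V : ℕ → Set X := fun n => closure (⋃ m ≥ n, A m)
  have hVQ : ∀ n, V n ⊆ Q := fun n =>
    closure_minimal (iUnion₂_subset fun m _ => hAQ m) hQ.isClosed
  have hVc : ∀ n, IsCompact (V n) := fun n => hQ.of_isClosed_subset isClosed_closure (hVQ n)
  have hVanti : Antitone V := fun m n hmn =>
    closure_mono (iUnion₂_subset fun k hk => subset_biUnion_of_mem (u := A) (hmn.trans hk))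
  have lim : ∀ {c : ℕ → X} {z : X}, (∀ n, c n ∈ A n) → Tendsto c atTop (𝓝 z) → z ∈ ⋂ n, V n := by
    intro c z hc hz
    refine mem_iInter.2 fun n => mem_closure_of_tendsto hz ?_
    filter_upwards [eventually_ge_atTop n] with m hm
    exact mem_biUnion (show m ∈ {m | m ≥ n} from hm) (hc m)
  have hTc : IsCompact (⋂ n, V n) := 
    (hVc 0).of_isClosed_subset (isClosed_iInter fun _ => isClosed_closure) (iInter_subset V 0)
  refine ⟨⋂ n, V n, ?_, hTc, ⟨⟨x, lim ha hx⟩, ?_⟩, lim ha hx, lim hb hy⟩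
  · exact (iInter_subset V 0).trans (closure_mono (iUnion₂_subset fun m _ => subset_iUnion A m))
  rw [isPreconnected_closed_iff]
  -- The upper limit is connected because `a m → x`: once `a m ∈ O`, the whole connected set `A m`
  -- lies in `O`, so no limit point can lie in `O'`.
  have key : ∀ P N : Set X, IsClosed P → IsClosed N → (⋂ n, V n) ⊆ P ∪ N → x ∈ P →
      ((⋂ n, V n) ∩ N).Nonempty → ((⋂ n, V n) ∩ (P ∩ N)).Nonempty := by
    intro P N hP hN hPN hxP ⟨z, hzT, hzN⟩
    by_contra hemp
    have hdis : Disjoint ((⋂ n, V n) ∩ P) ((⋂ n, V n) ∩ N) :=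
      disjoint_left.2 fun w hw hw' => hemp ⟨w, hw.1, hw.2, hw'.2⟩
    obtain ⟨O, O', hO, hO', hPO, hNO, hOO⟩ :=
      
      SeparatedNhds.of_isCompact_isCompact (hTc.inter_right hP) (hTc.inter_right hN) hdis
    obtain ⟨n, hn⟩ : ∃ n, V n ⊆ O ∪ O' := by
      by_contra! hcon
      obtain ⟨w, hw⟩ := IsCompact.nonempty_iInter_of_sequence_nonempty_isCompact_isClosed
        (fun n => V n \ (O ∪ O')) (fun n => sdiff_subset_sdiff_left (hVanti n.le_succ))
        (fun n => sdiff_nonempty.2 (hcon n)) ((hVc 0).diff (hO.union hO'))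
        (fun n => ((hVc n).diff (hO.union hO')).isClosed)
      rw [mem_iInter] at hw
      have hwT : w ∈ ⋂ n, V n := mem_iInter.2 fun n => (hw n).1
      rcases hPN hwT with h | h
      · exact (hw 0).2 (Or.inl (hPO ⟨hwT, h⟩))
      · exact (hw 0).2 (Or.inr (hNO ⟨hwT, h⟩))
    obtain ⟨N₀, hN₀⟩ := eventually_atTop.1
      (hx.eventually (hO.mem_nhds (hPO ⟨lim ha hx, hxP⟩)))
    have hsub : V (max n N₀) ⊆ closure O := by
      refine closure_mono (iUnion₂_subset fun m hm => ?_)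
      have hm1 : n ≤ m := (le_max_left _ _).trans hm
      have hm2 : N₀ ≤ m := (le_max_right _ _).trans hm
      have hAm : A m ⊆ O ∪ O' := fun w hw =>
        hn (subset_closure (mem_biUnion (show m ∈ {m | m ≥ n} from hm1) hw))
      exact (hA m).subset_left_of_subset_union hO hO' hOO hAm ⟨a m, ha m, hN₀ m hm2⟩
    have hzO' : z ∈ O' := hNO ⟨hzT, hzN⟩
    have hzO : z ∈ closure O := hsub (mem_iInter.1 hzT _)
    obtain ⟨w, hw', hw⟩ := mem_closure_iff.1 hzO O' hO' hzO'
    exact disjoint_left.1 hOO hw hw'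
  intro P N hP hN hPN hneP hneN
  rcases hPN (lim ha hx) with hxP | hxN
  · exact key P N hP hN hPN hxP hneN
  · rw [inter_comm P N]
    exact key N P hN hP (by rwa [union_comm]) hxN hneP

/-! ### Dimension zero and upper semicontinuous decompositions -/

theorem exists_isOpen_disjoint_closure {Z : Type*} [TopologicalSpace Z] [NormalSpace Z]
    {A B : Set Z} (hA : IsClosed A) (hB : IsClosed B) (h : Disjoint A B) :
    ∃ G H : Set Z, IsOpen G ∧ IsOpen H ∧ A ⊆ G ∧ B ⊆ H ∧ Disjoint (closure G) (closure H) := by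
  obtain ⟨G, hG, hAG, hGB⟩ := normal_exists_closure_subset hA hB.isOpen_compl
    (subset_compl_iff_disjoint_right.2 h)
  obtain ⟨H, hH, hBH, hHG⟩ := normal_exists_closure_subset hB isClosed_closure.isOpen_compl
    (subset_compl_comm.1 hGB)
  exact ⟨G, H, hG, hH, hAG, hBH, (subset_compl_iff_disjoint_right.1 hHG).symm⟩

/-- The countable sum theorem for dimension zero. -/
theorem exists_isClopen_of_iUnion_eq_univ {Z : Type*} [TopologicalSpace Z] [NormalSpace Z]
    {F : ℕ → Set Z} (hFu : ⋃ n, F n = univ)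
    (hF : ∀ n, ∀ A B : Set Z, IsClosed A → IsClosed B → Disjoint A B →
      ∃ C D : Set Z, IsClosed C ∧ IsClosed D ∧ Disjoint C D ∧ F n ⊆ C ∪ D ∧
        Disjoint C B ∧ Disjoint A D)
    {A B : Set Z} (hA : IsClosed A) (hB : IsClosed B) (h : Disjoint A B) :
    ∃ V, IsClopen V ∧ A ⊆ V ∧ Disjoint V B := by
  -- The invariant is disjointness of the closures, not merely of the open sets: the next piece is
  -- separated relative to these closures, then both sides are thickened again.
  have step : ∀ (n : ℕ) (p : {p : Set Z × Set Z // IsOpen p.1 ∧ IsOpen p.2 ∧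
      Disjoint (closure p.1) (closure p.2)}),
      ∃ q : {p : Set Z × Set Z // IsOpen p.1 ∧ IsOpen p.2 ∧
        Disjoint (closure p.1) (closure p.2)},
        p.1.1 ⊆ q.1.1 ∧ p.1.2 ⊆ q.1.2 ∧ F n ⊆ q.1.1 ∪ q.1.2 := by
    rintro n ⟨⟨G, H⟩, hG, hH, hGH⟩
    obtain ⟨C, D, hC, hD, hCD, hFn, hCB, hAD⟩ := hF n _ _ isClosed_closure isClosed_closure hGH
    obtain ⟨G', H', hG', hH', hGG', hHH', hd⟩ := exists_isOpen_disjoint_closure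
      (isClosed_closure.union hC) (isClosed_closure.union hD)
      (disjoint_union_left.2 ⟨disjoint_union_right.2 ⟨hGH, hAD⟩,
        disjoint_union_right.2 ⟨hCB, hCD⟩⟩)
    exact ⟨⟨(G', H'), hG', hH', hd⟩, (subset_closure.trans subset_union_left).trans hGG',
      (subset_closure.trans subset_union_left).trans hHH',
      hFn.trans (union_subset_union (subset_union_right.trans hGG')
        (subset_union_right.trans hHH'))⟩
  choose f hf₁ hf₂ hf₃ using step
  obtain ⟨G, H, hG, hH, hAG, hBH, hd⟩ := exists_isOpen_disjoint_closure hA hB h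
  let K : ℕ → {p : Set Z × Set Z // IsOpen p.1 ∧ IsOpen p.2 ∧
      Disjoint (closure p.1) (closure p.2)} :=
    fun n => Nat.rec ⟨(G, H), hG, hH, hd⟩ (fun n p => f n p) n
  have m₁ : Monotone fun n => (K n).1.1 := monotone_nat_of_le_succ fun n => hf₁ n (K n)
  have m₂ : Monotone fun n => (K n).1.2 := monotone_nat_of_le_succ fun n => hf₂ n (K n)
  have hdis : Disjoint (⋃ n, (K n).1.1) (⋃ n, (K n).1.2) := by
    rw [disjoint_left]
    intro z hz hz'
    obtain ⟨i, hi⟩ := mem_iUnion.1 hz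
    obtain ⟨j, hj⟩ := mem_iUnion.1 hz'
    exact disjoint_left.1 (K (max i j)).2.2.2 (subset_closure (m₁ (le_max_left i j) hi))
      (subset_closure (m₂ (le_max_right i j) hj))
  have hcov : univ ⊆ (⋃ n, (K n).1.1) ∪ (⋃ n, (K n).1.2) := by
    rw [← hFu]
    refine iUnion_subset fun n z hz => ?_
    rcases hf₃ n (K n) hz with h' | h'
    · exact Or.inl (mem_iUnion.2 ⟨n + 1, h'⟩)
    · exact Or.inr (mem_iUnion.2 ⟨n + 1, h'⟩)
  refine ⟨⋃ n, (K n).1.1, isClopen_of_disjoint_cover_open hcov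
    (isOpen_iUnion fun n => (K n).2.1) (isOpen_iUnion fun n => (K n).2.2.1) hdis,
    hAG.trans (subset_iUnion (fun n => (K n).1.1) 0),
    hdis.mono_right (hBH.trans (subset_iUnion (fun n => (K n).1.2) 0))⟩

/-- Clopen neighbourhoods of the classes of an upper semicontinuous equivalence relation with
compact classes, whose restriction to each of countably many compact pieces has a totally
separated quotient. -/
theorem Setoid.exists_isClopen_of_totallySeparated {S : Type*} [TopologicalSpace S]
    [MetrizableSpace S] (R : Setoid S)
    (husc : ∀ (x : S) (a b : ℕ → S), Tendsto a atTop (𝓝 x) → (∀ n, R (a n) (b n)) →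
      ∃ (y : S) (φ : ℕ → ℕ), StrictMono φ ∧ Tendsto (b ∘ φ) atTop (𝓝 y) ∧ R x y)
    {E : ℕ → Set S} (hEc : ∀ n, IsCompact (E n)) (hE : ⋃ n, E n = univ)
    (hsep : ∀ n, ∀ x ∈ E n, ∀ y ∈ E n, ¬ R x y → ∃ A B : Set S, IsClosed A ∧ IsClosed B ∧
      E n ⊆ A ∪ B ∧ x ∈ A ∧ y ∈ B ∧ ∀ a ∈ A, ∀ b ∈ B, ¬ R a b)
    {x : S} {W : Set S} (hW : IsOpen W) (hx : ∀ y, R x y → y ∈ W) :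
    ∃ V, IsClopen V ∧ x ∈ V ∧ V ⊆ W := by
  let π : S → Quotient R := Quotient.mk R
  have hπ : IsQuotientMap π := isQuotientMap_quotient_mk'
  have hRπ : ∀ {s t : S}, π s = π t ↔ R s t := Quotient.eq
  -- Upper semicontinuity enters only here. Closedness of `π` carries normality over to the
  -- quotient.
  have hcl : IsClosedMap π := by
    intro A hA
    rw [← hπ.isClosed_preimage]
    refine IsSeqClosed.isClosed fun b y hb hy => ?_
    choose a ha hab using hb
    obtain ⟨z, φ, hφ, hz, hyz⟩ := husc y b a hy fun n => R.symm (hRπ.1 (hab n))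
    exact ⟨z, hA.isSeqClosed (fun n => ha (φ n)) hz, hRπ.2 (R.symm hyz)⟩
  have hT1 : T1Space (Quotient R) := by
    refine ⟨fun z => ?_⟩
    obtain ⟨s, rfl⟩ := hπ.surjective z
    simpa using hcl {s} isClosed_singleton
  have hN : NormalSpace (Quotient R) := by
    refine ⟨fun A B hA hB hAB => ?_⟩
    obtain ⟨G, H, hG, hH, hAG, hBH, hGH⟩ := normal_separation (hA.preimage hπ.continuous)
      (hB.preimage hπ.continuous) (hAB.preimage π)
    refine ⟨(π '' Gᶜ)ᶜ, (π '' Hᶜ)ᶜ, (hcl _ hG.isClosed_compl).isOpen_compl,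
      (hcl _ hH.isClosed_compl).isOpen_compl, ?_, ?_, ?_⟩
    · rintro _ hz ⟨s, hs, rfl⟩
      exact hs (hAG hz)
    · rintro _ hz ⟨s, hs, rfl⟩
      exact hs (hBH hz)
    · rw [disjoint_left]
      intro z hz hz'
      obtain ⟨s, rfl⟩ := hπ.surjective z
      have h1 : s ∈ G := by_contra fun h => hz ⟨s, h, rfl⟩
      have h2 : s ∈ H := by_contra fun h => hz' ⟨s, h, rfl⟩
      exact disjoint_left.1 hGH h1 h2
  -- On a compact piece, total separation upgrades to clopen separation of disjoint closed sets,
  -- which is what the sum theorem consumes.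
  have hF : ∀ n, ∀ A B : Set (Quotient R), IsClosed A → IsClosed B → Disjoint A B →
      ∃ C D : Set (Quotient R), IsClosed C ∧ IsClosed D ∧ Disjoint C D ∧ π '' E n ⊆ C ∪ D ∧
        Disjoint C B ∧ Disjoint A D := by
    intro n A B hA hB hAB
    have hK : IsCompact (π '' E n) := (hEc n).image hπ.continuous
    have : CompactSpace ↥(π '' E n) := isCompact_iff_compactSpace.1 hK
    have : TotallySeparatedSpace ↥(π '' E n) := by
      refine ⟨fun z _ w _ hzw => ?_⟩
      obtain ⟨_, s, hs, rfl⟩ := z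
      obtain ⟨_, t, ht, rfl⟩ := w
      have hst : ¬ R s t := fun h => hzw (Subtype.ext (hRπ.2 h))
      obtain ⟨A', B', hA', hB', hcov, hsA, htB, hAB'⟩ := hsep n s hs t ht hst
      have hdis : Disjoint (π '' A') (π '' B') := by
        rw [disjoint_left]
        rintro _ ⟨p, hp, rfl⟩ ⟨q, hq, hqp⟩
        exact hAB' p hp q hq (R.symm (hRπ.1 hqp))
      refine ⟨Subtype.val ⁻¹' (π '' B')ᶜ, Subtype.val ⁻¹' (π '' A')ᶜ,
        (hcl _ hB').isOpen_compl.preimage continuous_subtype_val,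
        (hcl _ hA').isOpen_compl.preimage continuous_subtype_val,
        fun h => disjoint_left.1 hdis ⟨s, hsA, rfl⟩ h,
        fun h => disjoint_left.1 hdis h ⟨t, htB, rfl⟩, ?_, ?_⟩
      · rintro z -
        by_contra hcon
        simp only [mem_union, mem_preimage, mem_compl_iff, not_or, not_not] at hcon
        exact disjoint_left.1 hdis hcon.2 hcon.1
      · rw [disjoint_left]
        rintro ⟨_, p, hp, rfl⟩ hz hz'
        rcases hcov hp with h | h
        · exact hz' ⟨p, h, rfl⟩
        · exact hz ⟨p, h, rfl⟩
    obtain ⟨C, hC, hAC, hCB⟩ := exists_clopen_of_closed_subset_open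
      (Z := (Subtype.val : ↥(π '' E n) → Quotient R) ⁻¹' A) (U := Subtype.val ⁻¹' Bᶜ)
      (hA.preimage continuous_subtype_val) (hB.isOpen_compl.preimage continuous_subtype_val)
      (fun z hz hzB => disjoint_left.1 hAB hz hzB)
    refine ⟨Subtype.val '' C, Subtype.val '' Cᶜ,
      (hC.1.isCompact.image continuous_subtype_val).isClosed,
      (hC.2.isClosed_compl.isCompact.image continuous_subtype_val).isClosed,
      disjoint_image_of_injective Subtype.val_injective disjoint_compl_right, ?_, ?_, ?_⟩
    · rw [← image_union, union_compl_self]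
      exact fun z hz => ⟨⟨z, hz⟩, mem_univ _, rfl⟩
    · rw [disjoint_left]
      rintro _ ⟨c, hc, rfl⟩ hcB
      exact hCB hc hcB
    · rw [disjoint_left]
      rintro _ hcA ⟨c, hc, rfl⟩
      exact hc (hAC hcA)
  have hu : ⋃ n, π '' E n = univ := by
    rw [← image_iUnion, hE, image_univ, hπ.surjective.range_eq]
  obtain ⟨V, hV, hxV, hVW⟩ := exists_isClopen_of_iUnion_eq_univ hu hF
    (isClosed_singleton (x := π x)) (hcl _ hW.isClosed_compl) (by
      rw [disjoint_left]
      rintro z hz ⟨s, hs, rfl⟩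
      exact hs (hx s (hRπ.1 (mem_singleton_iff.1 hz).symm)))
  refine ⟨π ⁻¹' V, hV.preimage hπ.continuous, hxV rfl, fun s hs => ?_⟩
  by_contra hsW
  exact disjoint_left.1 hVW hs ⟨s, hsW, rfl⟩

/-! ### Arc components of a gapped parametrization -/

/-- `x` and `y` are equal, or are joined by the image of an interval contained in `F`. -/
def ArcJoined {X : Type*} (g : ℝ → X) (F : Set ℝ) (x y : X) : Prop :=
  x = y ∨ ∃ s t, uIcc s t ⊆ F ∧ g s = x ∧ g t = y

/-- `x` is joined to a point of `L`. -/
def ArcJoinedTo {X : Type*} (g : ℝ → X) (F : Set ℝ) (L : Set X) (x : X) : Prop :=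
  ∃ u ∈ L, ArcJoined g F x u

/-- `x` and `y` are joined by an arc, or both are joined to `L`. -/
def ArcJoinedMod {X : Type*} (g : ℝ → X) (F : Set ℝ) (L : Set X) (x y : X) : Prop :=
  ArcJoined g F x y ∨ (ArcJoinedTo g F L x ∧ ArcJoinedTo g F L y)

/-- A closed set `S` that is the union of a compact set `L` and an injective image of a closed set
of reals with gaps arbitrarily far out on both sides, whose arcs satisfy a compactness condition. -/
structure IsGappedParametrization {X : Type*} [TopologicalSpace X] (g : ℝ → X) (F : Set ℝ)
    (L S : Set X) : Prop where
  isClosed_dom : IsClosed F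
  isClosed : IsClosed S
  continuousOn : ContinuousOn g F
  injOn : InjOn g F
  isCompact : IsCompact L
  union_eq : L ∪ g '' F = S
  exists_ge : ∀ r, ∃ t ≥ r, t ∉ F
  exists_le : ∀ r, ∃ t ≤ r, t ∉ F
  isCompact_closure : ∀ (s t : ℕ → ℝ) (x : X), (∀ n, s n ≠ t n) → (∀ n, uIcc (s n) (t n) ⊆ F) →
    Tendsto (g ∘ s) atTop (𝓝 x) → IsCompact (closure (⋃ n, g '' uIcc (s n) (t n)))

section ArcJoined

variable {X : Type*} {g : ℝ → X} {F : Set ℝ} {L : Set X} {x y z : X}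

theorem ArcJoined.refl (x : X) : ArcJoined g F x x := Or.inl rfl

theorem ArcJoined.symm (h : ArcJoined g F x y) : ArcJoined g F y x := by
  rcases h with rfl | ⟨s, t, hst, rfl, rfl⟩
  · exact Or.inl rfl
  · exact Or.inr ⟨t, s, uIcc_comm s t ▸ hst, rfl, rfl⟩

theorem ArcJoined.trans (hg : InjOn g F) (h : ArcJoined g F x y) (h' : ArcJoined g F y z) :
    ArcJoined g F x z := by
  rcases h with rfl | ⟨s, t, hst, rfl, rfl⟩
  · exact h'
  rcases h' with rfl | ⟨t', r, htr, htt, rfl⟩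
  · exact Or.inr ⟨s, t, hst, rfl, rfl⟩
  obtain rfl := hg (htr left_mem_uIcc) (hst right_mem_uIcc) htt
  exact Or.inr ⟨s, r, uIcc_subset_uIcc_union_uIcc.trans (union_subset hst htr), rfl, rfl⟩

theorem ArcJoinedTo.congr (hg : InjOn g F) (h : ArcJoinedTo g F L x) (hxy : ArcJoined g F x y) :
    ArcJoinedTo g F L y := by
  obtain ⟨u, hu, hxu⟩ := h
  exact ⟨u, hu, hxy.symm.trans hg hxu⟩

theorem ArcJoinedMod.symm (h : ArcJoinedMod g F L x y) : ArcJoinedMod g F L y x :=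
  h.imp ArcJoined.symm And.symm

theorem ArcJoinedMod.arcJoinedTo (hg : InjOn g F) (h : ArcJoinedMod g F L x y)
    (hx : ArcJoinedTo g F L x) : ArcJoinedTo g F L y :=
  h.elim (fun h => hx.congr hg h) And.right

theorem ArcJoinedMod.trans (hg : InjOn g F) (h : ArcJoinedMod g F L x y)
    (h' : ArcJoinedMod g F L y z) : ArcJoinedMod g F L x z := by
  rcases h with h | ⟨hx, hy⟩
  · rcases h' with h' | ⟨hy, hz⟩
    · exact Or.inl (h.trans hg h')
    · exact Or.inr ⟨hy.congr hg h.symm, hz⟩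
  · exact Or.inr ⟨hx, h'.arcJoinedTo hg hy⟩

end ArcJoined

namespace IsGappedParametrization

variable {X : Type*} [TopologicalSpace X] [MetrizableSpace X] {g : ℝ → X} {F : Set ℝ}
  {L S : Set X}

/-- A continuum in the injective image of a closed set of reals with gaps arbitrarily far out is
an arc. -/
theorem arcJoined_of_isConnected (h : IsGappedParametrization g F L S) {T : Set X}
    (hT : IsConnected T) (hTc : IsCompact T) (hTF : T ⊆ g '' F) {x y : X} (hx : x ∈ T)
    (hy : y ∈ T) : ArcJoined g F x y := by
  let _ := metrizableSpaceMetric X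
  choose hi hhi hhiF using h.exists_ge
  choose lo hlo hloF using h.exists_le
  let I : ℕ → Set ℝ := fun n => Icc (lo (-n)) (hi n)
  -- Cut `F` at gaps into compact pieces. As the end points of `I m` lie outside `F`, removing the
  -- open intervals removes all of `F ∩ I m`, so the pieces are disjoint.
  let P : ℕ → Set ℝ := fun n => (F ∩ I n) \ ⋃ m < n, Ioo (lo (-m)) (hi m)
  have hPF : ∀ n, P n ⊆ F := fun n t ht => ht.1.1
  have hPc : ∀ n, IsCompact (P n) := fun n =>
    (isCompact_Icc.inter_left h.isClosed_dom).diff (isOpen_biUnion fun m _ => isOpen_Ioo)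
  have hPd : ∀ {i j t}, i < j → t ∈ P i → t ∉ P j := by
    intro i j t hij hi' hj
    refine hj.2 (mem_biUnion (show i ∈ {m | m < j} from hij) ⟨?_, ?_⟩)
    · exact lt_of_le_of_ne hi'.1.2.1 fun e => hloF _ (e ▸ hi'.1.1)
    · exact lt_of_le_of_ne hi'.1.2.2 fun e => hhiF _ (e ▸ hi'.1.1)
  have hcov : ∀ t ∈ F, ∃ n, t ∈ P n := by
    classical
    intro t ht
    have hex : ∃ n, t ∈ I n := by
      obtain ⟨n, hn⟩ := exists_nat_ge |t|
      exact ⟨n, (hlo _).trans ((neg_le_neg hn).trans (neg_abs_le t)),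
        (le_abs_self t).trans (hn.trans (hhi _))⟩
    refine ⟨Nat.find hex, ⟨ht, Nat.find_spec hex⟩, ?_⟩
    simp only [mem_iUnion, not_exists]
    exact fun m hm hmt => Nat.find_min hex hm (Ioo_subset_Icc_self hmt)
  have himc : ∀ {A : Set ℝ}, A ⊆ F → IsCompact A → IsClosed (g '' A) := fun hAF hA =>
    (hA.image_of_continuousOn (h.continuousOn.mono hAF)).isClosed
  have himd : ∀ i j, i < j → Disjoint (g '' P i) (g '' P j) := by
    intro i j hij
    rw [disjoint_left]
    rintro _ ⟨s, hs, rfl⟩ ⟨t, ht, hst⟩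
    obtain rfl := h.injOn (hPF _ ht) (hPF _ hs) hst
    exact hPd hij hs ht
  obtain ⟨n, hn⟩ := hT.exists_subset_of_pairwise_disjoint_isClosed hTc
    (P := fun n => g '' P n) (fun n => himc (hPF n) (hPc n))
    (fun i j hij => hij.lt_or_gt.elim (himd i j) fun h => (himd j i h).symm)
    (by
      intro z hz
      obtain ⟨t, ht, rfl⟩ := hTF hz
      obtain ⟨n, hn⟩ := hcov t ht
      exact mem_iUnion.2 ⟨n, t, hn, rfl⟩)
  obtain ⟨s, hs, rfl⟩ := hn hx
  obtain ⟨t, ht, rfl⟩ := hn hy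
  refine Or.inr ⟨s, t, fun r hr => ?_, rfl, rfl⟩
  -- A gap `r` between `s` and `t` would split `T` into the images of the parameters below and above
  -- it.
  by_contra hrF
  have hl : P n ∩ Iic r ⊆ F := fun p hp => hPF n hp.1
  have hu : P n ∩ Ici r ⊆ F := fun p hp => hPF n hp.1
  have cl := himc hl ((hPc n).inter_right isClosed_Iic)
  have cu := himc hu ((hPc n).inter_right isClosed_Ici)
  have hcover : T ⊆ g '' (P n ∩ Iic r) ∪ g '' (P n ∩ Ici r) := by
    intro z hz
    obtain ⟨p, hp, rfl⟩ := hn hz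
    exact (le_total p r).imp (fun h => ⟨p, ⟨hp, h⟩, rfl⟩) (fun h => ⟨p, ⟨hp, h⟩, rfl⟩)
  have hne : (T ∩ g '' (P n ∩ Iic r)).Nonempty ∧ (T ∩ g '' (P n ∩ Ici r)).Nonempty := by
    rcases mem_uIcc.1 hr with ⟨h1, h2⟩ | ⟨h1, h2⟩
    · exact ⟨⟨g s, hx, s, ⟨hs, h1⟩, rfl⟩, ⟨g t, hy, t, ⟨ht, h2⟩, rfl⟩⟩
    · exact ⟨⟨g t, hy, t, ⟨ht, h1⟩, rfl⟩, ⟨g s, hx, s, ⟨hs, h2⟩, rfl⟩⟩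
  obtain ⟨_, -, ⟨p, hp, rfl⟩, q, hq, hqp⟩ :=
    isPreconnected_closed_iff.1 hT.isPreconnected _ _ cl cu hcover hne.1 hne.2
  obtain rfl := h.injOn (hu hq) (hl hp) hqp
  exact hrF (le_antisymm (mem_Iic.1 hp.2) (mem_Ici.1 hq.2) ▸ hl hp)

/-- A continuum in `S` that meets `L` consists of points joined to `L`. -/
theorem arcJoinedTo_of_isConnected (h : IsGappedParametrization g F L S) {T : Set X}
    (hT : IsConnected T) (hTc : IsCompact T) (hTS : T ⊆ S) (hTL : (T ∩ L).Nonempty) {x : X}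
    (hx : x ∈ T) : ArcJoinedTo g F L x := by
  let _ := metrizableSpaceMetric X
  by_cases hxL : x ∈ L
  · exact ⟨x, hxL, ArcJoined.refl x⟩
  obtain ⟨w, hwT, hwL⟩ := hTL
  have hLne : L.Nonempty := ⟨w, hwL⟩
  have hpos : 0 < Metric.infDist x L :=
    (h.isCompact.isClosed.notMem_iff_infDist_pos hLne).1 hxL
  -- Scaled so that `ε k` never exceeds the distance from `x` to `L`. Bumping inside the points at
  -- distance at least `ε k` gives continua off `L`, hence arcs, from `x` to within `ε k` of `L`.
  let ε : ℕ → ℝ := fun k => Metric.infDist x L * (1 / ((k : ℝ) + 1))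
  have hεpos : ∀ k, 0 < ε k := fun k => mul_pos hpos (by positivity)
  have hεle : ∀ k, ε k ≤ Metric.infDist x L := fun k =>
    mul_le_of_le_one_right hpos.le (by rw [div_le_one (by positivity)]; simp)
  have hεlim : Tendsto ε atTop (𝓝 0) := by
    have := (tendsto_one_div_add_atTop_nhds_zero_nat (𝕜 := ℝ)).const_mul (Metric.infDist x L)
    rwa [mul_zero] at this
  have hex : ∀ k, ∃ s t, uIcc s t ⊆ F ∧ g s = x ∧ Metric.infDist (g t) L ≤ ε k := by
    intro k
    have hE : IsClosed {p | ε k ≤ Metric.infDist p L} :=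
      isClosed_le continuous_const (Metric.continuous_infDist_pt L)
    obtain ⟨C, hC, hCc, hCconn, hxC, p, hpC, hp⟩ :=
      hT.isPreconnected.exists_isConnected_inter_closure_compl_nonempty hTc hx hE (hεle k)
        (fun hsub => absurd (hsub hwT) (by
          simpa [Metric.infDist_zero_of_mem hwL] using hεpos k))
    have hCF : C ⊆ g '' F := by
      intro c hc
      have hcS := hTS (hC hc).1
      rw [← h.union_eq] at hcS
      refine hcS.resolve_left fun hcL => ?_
      have := (hC hc).2
      simp only [mem_ofPred_eq, Metric.infDist_zero_of_mem hcL] at this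
      exact absurd this (not_le.2 (hεpos k))
    have hple : Metric.infDist p L ≤ ε k := by
      have : closure {p | ε k ≤ Metric.infDist p L}ᶜ ⊆ {p | Metric.infDist p L ≤ ε k} :=
        closure_minimal (fun q hq => le_of_not_ge (show ¬ ε k ≤ Metric.infDist q L from hq))
          (isClosed_le (Metric.continuous_infDist_pt L) continuous_const)
      exact this hp
    rcases h.arcJoined_of_isConnected hCconn hCc hCF hxC hpC with rfl | ⟨s, t, hst, hs, ht⟩
    · obtain ⟨s, hs, rfl⟩ := hCF hxC
      exact ⟨s, s, by simpa using hs, rfl, hple⟩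
    · exact ⟨s, t, hst, hs, ht ▸ hple⟩
  choose s t hst hs ht using hex
  have hss : ∀ k, s k = s 0 := fun k =>
    h.injOn (hst k left_mem_uIcc) (hst 0 left_mem_uIcc) ((hs k).trans (hs 0).symm)
  -- The arcs all start at parameter `s 0` and cannot jump a gap, so their other end points stay
  -- bounded and accumulate at some `r` with `g r ∈ L`.
  obtain ⟨b, hb, hbF⟩ := h.exists_ge (s 0)
  obtain ⟨a, ha, haF⟩ := h.exists_le (s 0)
  have htI : ∀ k, t k ∈ Icc a b := by
    intro k
    have hk := hst k
    rw [hss k] at hk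
    refine ⟨le_of_not_gt fun hlt => haF (hk ?_), le_of_not_gt fun hlt => hbF (hk ?_)⟩
    · exact mem_uIcc.2 (Or.inr ⟨hlt.le, ha⟩)
    · exact mem_uIcc.2 (Or.inl ⟨hb, hlt.le⟩)
  obtain ⟨r, -, φ, hφ, hr⟩ := isCompact_Icc.tendsto_subseq htI
  have hsF : s 0 ∈ F := hst 0 left_mem_uIcc
  have hrF : r ∈ F := h.isClosed_dom.mem_of_tendsto hr
    (Eventually.of_forall fun k => hst _ right_mem_uIcc)
  have hsr : uIcc (s 0) r ⊆ F := by
    intro q hq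
    rcases eq_or_ne q r with rfl | hqr
    · exact hrF
    rcases mem_uIcc.1 hq with ⟨h1, h2⟩ | ⟨h1, h2⟩
    · obtain ⟨k, hk⟩ := (hr.eventually (lt_mem_nhds (lt_of_le_of_ne h2 hqr))).exists
      exact hst (φ k) (hss (φ k) ▸ mem_uIcc.2 (Or.inl ⟨h1, hk.le⟩))
    · obtain ⟨k, hk⟩ := (hr.eventually (gt_mem_nhds (lt_of_le_of_ne h1 hqr.symm))).exists
      exact hst (φ k) (hss (φ k) ▸ mem_uIcc.2 (Or.inr ⟨hk.le, h2⟩))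
  have hgr : Tendsto (fun k => g (t (φ k))) atTop (𝓝 (g r)) :=
    (h.continuousOn r hrF).tendsto.comp (tendsto_nhdsWithin_iff.2
      ⟨hr, Eventually.of_forall fun k => hst _ right_mem_uIcc⟩)
  have h0 : Metric.infDist (g r) L ≤ 0 :=
    le_of_tendsto_of_tendsto (((Metric.continuous_infDist_pt L).tendsto _).comp hgr)
      (hεlim.comp hφ.tendsto_atTop) (Eventually.of_forall fun k => ht (φ k))
  refine ⟨g r, ?_, Or.inr ⟨s 0, r, hsr, hs 0, rfl⟩⟩
  rw [h.isCompact.isClosed.mem_iff_infDist_zero hLne]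
  exact le_antisymm h0 Metric.infDist_nonneg

theorem arcJoinedMod_of_isConnected (h : IsGappedParametrization g F L S) {T : Set X}
    (hT : IsConnected T) (hTc : IsCompact T) (hTS : T ⊆ S) {x y : X} (hx : x ∈ T) (hy : y ∈ T) :
    ArcJoinedMod g F L x y := by
  by_cases hTL : (T ∩ L).Nonempty
  · exact Or.inr ⟨h.arcJoinedTo_of_isConnected hT hTc hTS hTL hx,
      h.arcJoinedTo_of_isConnected hT hTc hTS hTL hy⟩
  · refine Or.inl (h.arcJoined_of_isConnected hT hTc (fun z hz => ?_) hx hy)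
    have := hTS hz
    rw [← h.union_eq] at this
    exact this.resolve_left fun hzL => hTL ⟨z, hz, hzL⟩

/-- The joining arcs lie in a compact set, and a limit of them is a continuum in `S` through `x` and
`y`. This limit may run into `L`, which is why only `ArcJoinedMod` survives. -/
theorem exists_subseq_of_arcJoined (h : IsGappedParametrization g F L S) {x : X} {a b : ℕ → X}
    (ha : Tendsto a atTop (𝓝 x)) (hab : ∀ n, ArcJoined g F (a n) (b n)) :
    ∃ (y : X) (φ : ℕ → ℕ), StrictMono φ ∧ Tendsto (b ∘ φ) atTop (𝓝 y) ∧
      ArcJoinedMod g F L x y := by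
  let _ := metrizableSpaceMetric X
  -- Degenerate arcs are treated apart, since the compactness condition concerns only `s n ≠ t n`.
  by_cases hfr : ∃ᶠ n in atTop, a n = b n
  · obtain ⟨φ, hφ, hφab⟩ := extraction_of_frequently_atTop hfr
    refine ⟨x, φ, hφ, ?_, Or.inl (ArcJoined.refl x)⟩
    exact (ha.comp hφ.tendsto_atTop).congr fun n => hφab n
  obtain ⟨ψ, hψ, hψab⟩ := extraction_of_eventually_atTop (not_frequently.1 hfr)
  have hex : ∀ n, ∃ s t, uIcc s t ⊆ F ∧ g s = a (ψ n) ∧ g t = b (ψ n) := fun n =>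
    (hab (ψ n)).resolve_left (hψab n)
  choose s t hst hs ht using hex
  have hne : ∀ n, s n ≠ t n := fun n e => hψab n (by rw [← hs, ← ht, e])
  have has : Tendsto (g ∘ s) atTop (𝓝 x) :=
    (ha.comp hψ.tendsto_atTop).congr fun n => (hs n).symm
  have hQ := h.isCompact_closure s t x hne hst has
  have hsub : ∀ n, g '' uIcc (s n) (t n) ⊆ closure (⋃ n, g '' uIcc (s n) (t n)) := fun n =>
    (subset_iUnion (fun n => g '' uIcc (s n) (t n)) n).trans subset_closure
  obtain ⟨y, -, φ, hφ, hy⟩ := hQ.tendsto_subseq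
    (x := g ∘ t) (fun n => hsub n ⟨t n, right_mem_uIcc, rfl⟩)
  obtain ⟨T, hTsub, hTc, hT, hxT, hyT⟩ := hQ.exists_isConnected_of_tendsto
    (A := fun n => g '' uIcc (s (φ n)) (t (φ n)))
    (fun n => isPreconnected_uIcc.image g (h.continuousOn.mono (hst _))) (fun n => hsub (φ n))
    (fun n => ⟨s (φ n), left_mem_uIcc, rfl⟩) (fun n => ⟨t (φ n), right_mem_uIcc, rfl⟩)
    (has.comp hφ.tendsto_atTop) hy
  have hTS : T ⊆ S := hTsub.trans (closure_minimal (iUnion_subset fun n => by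
    rw [← h.union_eq]
    exact (image_mono (hst _)).trans subset_union_right) h.isClosed)
  exact ⟨y, ψ ∘ φ, hψ.comp hφ, hy.congr fun n => ht (φ n),
    h.arcJoinedMod_of_isConnected hT hTc hTS hxT hyT⟩

theorem arcJoinedTo_of_tendsto (h : IsGappedParametrization g F L S) {x : X} {a : ℕ → X}
    (ha : Tendsto a atTop (𝓝 x)) (hal : ∀ n, ArcJoinedTo g F L (a n)) : ArcJoinedTo g F L x := by
  let _ := metrizableSpaceMetric X
  choose u huL hu using hal
  obtain ⟨y, φ, -, hy, hxy⟩ := h.exists_subseq_of_arcJoined ha hu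
  have hyL : y ∈ L := h.isCompact.isClosed.mem_of_tendsto hy
    (Eventually.of_forall fun n => huL (φ n))
  exact hxy.symm.arcJoinedTo h.injOn ⟨y, hyL, ArcJoined.refl y⟩

theorem isClosed_arcJoinedTo (h : IsGappedParametrization g F L S) :
    IsClosed {x | ArcJoinedTo g F L x} := by
  let _ := metrizableSpaceMetric X
  exact IsSeqClosed.isClosed fun a x ha hx => h.arcJoinedTo_of_tendsto hx ha

theorem exists_subseq_of_arcJoinedTo (h : IsGappedParametrization g F L S) {b : ℕ → X}
    (hb : ∀ n, ArcJoinedTo g F L (b n)) :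
    ∃ (y : X) (φ : ℕ → ℕ), StrictMono φ ∧ Tendsto (b ∘ φ) atTop (𝓝 y) := by
  let _ := metrizableSpaceMetric X
  choose u huL hu using hb
  obtain ⟨w, -, φ, hφ, hw⟩ := h.isCompact.tendsto_subseq huL
  obtain ⟨y, ψ, hψ, hy, -⟩ := h.exists_subseq_of_arcJoined hw fun n => (hu (φ n)).symm
  exact ⟨y, φ ∘ ψ, hφ.comp hψ, hy⟩

/-- The relation `ArcJoinedMod` is upper semicontinuous with compact classes. -/
theorem exists_subseq_of_arcJoinedMod (h : IsGappedParametrization g F L S) {x : X} {a b : ℕ → X}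
    (ha : Tendsto a atTop (𝓝 x)) (hab : ∀ n, ArcJoinedMod g F L (a n) (b n)) :
    ∃ (y : X) (φ : ℕ → ℕ), StrictMono φ ∧ Tendsto (b ∘ φ) atTop (𝓝 y) ∧
      ArcJoinedMod g F L x y := by
  by_cases hfr : ∃ᶠ n in atTop, ArcJoined g F (a n) (b n)
  · obtain ⟨φ, hφ, hφab⟩ := extraction_of_frequently_atTop hfr
    obtain ⟨y, ψ, hψ, hy, hxy⟩ := h.exists_subseq_of_arcJoined (ha.comp hφ.tendsto_atTop) hφab
    exact ⟨y, φ ∘ ψ, hφ.comp hψ, hy, hxy⟩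
  obtain ⟨φ, hφ, hφab⟩ := extraction_of_eventually_atTop (not_frequently.1 hfr)
  have hl := fun n => (hab (φ n)).resolve_left (hφab n)
  obtain ⟨y, ψ, hψ, hy⟩ := h.exists_subseq_of_arcJoinedTo fun n => (hl n).2
  exact ⟨y, φ ∘ ψ, hφ.comp hψ, hy, Or.inr ⟨h.arcJoinedTo_of_tendsto
    (ha.comp hφ.tendsto_atTop) fun n => (hl n).1,
    h.arcJoinedTo_of_tendsto hy fun n => (hl (ψ n)).2⟩⟩

/-- The first point of `N` to the right of `s` cannot be reached from `s` inside `F`, so a gap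
precedes it; if there is no such point, any gap will do. -/
theorem exists_gap_ge {F N : Set ℝ} (hF : ∀ r, ∃ t ≥ r, t ∉ F) (hN : IsClosed N) (hNF : N ⊆ F)
    {s : ℝ} (h : ∀ m ∈ N, ¬ uIcc s m ⊆ F) : ∃ b ≥ s, b ∉ F ∧ ∀ r ∈ Icc s b, r ∉ N := by
  rcases (N ∩ Ici s).eq_empty_or_nonempty with hemp | hne
  · obtain ⟨b, hb, hbF⟩ := hF s
    exact ⟨b, hb, hbF, fun r hr hrN => hemp.subset ⟨hrN, hr.1⟩⟩
  have hbdd : BddBelow (N ∩ Ici s) := ⟨s, fun r hr => hr.2⟩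
  have hm := (hN.inter isClosed_Ici).csInf_mem hne hbdd
  obtain ⟨b, hb, hbF⟩ := not_subset.1 (h _ hm.1)
  rw [uIcc_of_le hm.2] at hb
  refine ⟨b, hb.1, hbF, fun r hr hrN => ?_⟩
  have : sInf (N ∩ Ici s) ≤ r := csInf_le hbdd ⟨hrN, hr.1⟩
  exact hbF (le_antisymm hb.2 (this.trans hr.2) ▸ hNF hm.1)

theorem exists_gap_le {F N : Set ℝ} (hF : ∀ r, ∃ t ≤ r, t ∉ F) (hN : IsClosed N) (hNF : N ⊆ F)
    {s : ℝ} (h : ∀ m ∈ N, ¬ uIcc s m ⊆ F) : ∃ a ≤ s, a ∉ F ∧ ∀ r ∈ Icc a s, r ∉ N := by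
  rcases (N ∩ Iic s).eq_empty_or_nonempty with hemp | hne
  · obtain ⟨b, hb, hbF⟩ := hF s
    exact ⟨b, hb, hbF, fun r hr hrN => hemp.subset ⟨hrN, hr.2⟩⟩
  have hbdd : BddAbove (N ∩ Iic s) := ⟨s, fun r hr => hr.2⟩
  have hm := (hN.inter isClosed_Iic).csSup_mem hne hbdd
  obtain ⟨b, hb, hbF⟩ := not_subset.1 (h _ hm.1)
  rw [uIcc_of_ge hm.2] at hb
  refine ⟨b, hb.2, hbF, fun r hr hrN => ?_⟩
  have : r ≤ sSup (N ∩ Iic s) := le_csSup hbdd ⟨hrN, hr.2⟩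
  exact hbF (le_antisymm (hr.1.trans this) hb.1 ▸ hNF hm.1)

/-- Two points that are not related, the first of which is not joined to `L`, are separated in
every compact piece of the parametrization. -/
theorem exists_separation (h : IsGappedParametrization g F L S) {K : Set ℝ} (hK : IsCompact K)
    {s t : ℝ} (hs : s ∈ F ∩ K) (ht : t ∈ F ∩ K) (hl : ¬ ArcJoinedTo g F L (g s))
    (hst : ¬ ArcJoinedMod g F L (g s) (g t)) :
    ∃ A B : Set X, IsClosed A ∧ IsClosed B ∧ g '' (F ∩ K) ⊆ A ∪ B ∧ g s ∈ A ∧ g t ∈ B ∧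
      ∀ a ∈ A, ∀ b ∈ B, ¬ ArcJoinedMod g F L a b := by
  -- The parameters to be kept away from `s`: those joined to `L`, and `t`. Gaps `a` and `b` around
  -- `s` enclose none of them, so cutting at `a` and `b` cuts no class.
  let N : Set ℝ := (F ∩ g ⁻¹' {x | ArcJoinedTo g F L x}) ∪ {t}
  have hN : IsClosed N := (h.continuousOn.preimage_isClosed_of_isClosed h.isClosed_dom
    h.isClosed_arcJoinedTo).union isClosed_singleton
  have hNF : N ⊆ F := union_subset inter_subset_left (singleton_subset_iff.2 ht.1)
  have hsN : ∀ m ∈ N, ¬ uIcc s m ⊆ F := by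
    intro m hm hsub
    have hj : ArcJoined g F (g s) (g m) := Or.inr ⟨s, m, hsub, rfl, rfl⟩
    rcases hm with ⟨-, hm⟩ | hm
    · exact hl (ArcJoinedTo.congr h.injOn hm hj.symm)
    · exact hst (Or.inl (mem_singleton_iff.1 hm ▸ hj))
  obtain ⟨b, hsb, hbF, hb⟩ := exists_gap_ge h.exists_ge hN hNF hsN
  obtain ⟨a, has, haF, ha⟩ := exists_gap_le h.exists_le hN hNF hsN
  have hab : ∀ r ∈ Icc a b, r ∉ N := fun r hr =>
    (le_total r s).elim (fun hrs => ha r ⟨hr.1, hrs⟩) (fun hrs => hb r ⟨hrs, hr.2⟩)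
  have hFK : IsCompact (F ∩ K) := hK.inter_left h.isClosed_dom
  have hcl : ∀ {A : Set ℝ}, A ⊆ F → IsCompact A → IsClosed (g '' A) := fun hAF hA =>
    (hA.image_of_continuousOn (h.continuousOn.mono hAF)).isClosed
  refine ⟨g '' ((F ∩ K) ∩ Icc a b), g '' ((F ∩ K) \ Ioo a b),
    hcl (fun r hr => hr.1.1) (hFK.inter_right isClosed_Icc),
    hcl (fun r hr => hr.1.1) (hFK.diff isOpen_Ioo), ?_, ⟨s, ⟨hs, has, hsb⟩, rfl⟩,
    ⟨t, ⟨ht, fun hm => hab t (Ioo_subset_Icc_self hm) (Or.inr rfl)⟩, rfl⟩, ?_⟩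
  · rintro _ ⟨r, hr, rfl⟩
    by_cases hrI : r ∈ Icc a b
    · exact Or.inl ⟨r, ⟨hr, hrI⟩, rfl⟩
    · exact Or.inr ⟨r, ⟨hr, fun hm => hrI (Ioo_subset_Icc_self hm)⟩, rfl⟩
  rintro _ ⟨p, hp, rfl⟩ _ ⟨q, hq, rfl⟩ (hpq | hpq)
  · have hsub : uIcc p q ⊆ F := by
      rcases hpq with hpq | ⟨p', q', hsub, hp', hq'⟩
      · obtain rfl := h.injOn hp.1.1 hq.1.1 hpq
        simpa using hp.1.1
      · obtain rfl := h.injOn (hsub left_mem_uIcc) hp.1.1 hp'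
        obtain rfl := h.injOn (hsub right_mem_uIcc) hq.1.1 hq'
        exact hsub
    rcases le_or_gt q a with hqa | hqa
    · exact haF (hsub (mem_uIcc.2 (Or.inr ⟨hqa, hp.2.1⟩)))
    · have hbq : b ≤ q := le_of_not_gt fun hqb => hq.2 ⟨hqa, hqb⟩
      exact hbF (hsub (mem_uIcc.2 (Or.inl ⟨hp.2.2, hbq⟩)))
  · exact hab p hp.2 (Or.inl ⟨hp.1.1, hpq.1⟩)

/-- The classes of `ArcJoinedMod` in `S` have arbitrarily small clopen neighbourhoods. -/
theorem exists_isClopen (h : IsGappedParametrization g F L S) {x : S} {W : Set S} (hW : IsOpen W)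
    (hx : ∀ y : S, ArcJoinedMod g F L (x : X) y → y ∈ W) : ∃ V, IsClopen V ∧ x ∈ V ∧ V ⊆ W := by
  let R : Setoid S :=
    { r := fun x y => ArcJoinedMod g F L (x : X) y
      iseqv := ⟨fun x => Or.inl (ArcJoined.refl _), ArcJoinedMod.symm,
        fun h₁ h₂ => h₁.trans h.injOn h₂⟩ }
  have hemb := h.isClosed.isClosedEmbedding_subtypeVal
  let E : ℕ → Set X := fun n => Nat.casesOn n L fun n => g '' (F ∩ Icc (-(n : ℝ)) n)
  have hEc : ∀ n, IsCompact (E n) := by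
    rintro (_ | n)
    · exact h.isCompact
    · exact (isCompact_Icc.inter_left h.isClosed_dom).image_of_continuousOn
        (h.continuousOn.mono inter_subset_left)
  refine R.exists_isClopen_of_totallySeparated (E := fun n => Subtype.val ⁻¹' E n) ?_
    (fun n => hemb.isCompact_preimage (hEc n)) ?_ ?_ hW hx
  · intro x a b ha hab
    obtain ⟨y, φ, hφ, hy, hxy⟩ := h.exists_subseq_of_arcJoinedMod
      ((continuous_subtype_val.tendsto x).comp ha) hab
    have hyS : y ∈ S := h.isClosed.mem_of_tendsto hy (Eventually.of_forall fun n => (b (φ n)).2)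
    exact ⟨⟨y, hyS⟩, φ, hφ, tendsto_subtype_rng.2 hy, hxy⟩
  · rw [← preimage_iUnion]
    refine eq_univ_of_forall fun z => ?_
    rcases h.union_eq.symm.subset z.2 with hz | ⟨t, ht, htz⟩
    · exact mem_iUnion.2 ⟨0, hz⟩
    · obtain ⟨n, hn⟩ := exists_nat_ge |t|
      exact mem_iUnion.2 ⟨n + 1, t, ⟨ht, abs_le.1 hn⟩, htz⟩
  · intro n x hxn y hyn hxy
    change ¬ ArcJoinedMod g F L (x : X) y at hxy
    suffices H : ∃ A B : Set X, IsClosed A ∧ IsClosed B ∧ E n ⊆ A ∪ B ∧ (x : X) ∈ A ∧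
        (y : X) ∈ B ∧ ∀ a ∈ A, ∀ b ∈ B, ¬ ArcJoinedMod g F L a b by
      obtain ⟨A, B, hA, hB, hE, hxA, hyB, hAB⟩ := H
      exact ⟨_, _, hA.preimage continuous_subtype_val, hB.preimage continuous_subtype_val,
        fun z hz => hE hz, hxA, hyB, fun a ha b hb => hAB a ha b hb⟩
    rcases n with _ | n
    · exact absurd (Or.inr ⟨⟨x, hxn, ArcJoined.refl _⟩, ⟨y, hyn, ArcJoined.refl _⟩⟩) hxy
    obtain ⟨s, hs, hsx⟩ := hxn
    obtain ⟨t, ht, hty⟩ := hyn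
    rw [← hsx, ← hty] at hxy ⊢
    -- At most one of the two points is joined to `L`; the other one must play the first role in the
    -- separation.
    by_cases hl : ArcJoinedTo g F L (g s)
    · obtain ⟨A, B, hA, hB, hE, htA, hsB, hAB⟩ := h.exists_separation isCompact_Icc ht hs
        (fun hl' => hxy (Or.inr ⟨hl, hl'⟩)) (fun hts => hxy hts.symm)
      exact ⟨B, A, hB, hA, union_comm A B ▸ hE, hsB, htA, fun b hb a ha hba =>
        hAB a ha b hb hba.symm⟩
    · exact h.exists_separation isCompact_Icc hs ht hl hxy

theorem isCompact_class (h : IsGappedParametrization g F L S) (x : X) :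
    IsCompact {y | ArcJoinedMod g F L x y} := by
  let _ := metrizableSpaceMetric X
  refine IsSeqCompact.isCompact fun b hb => ?_
  obtain ⟨y, φ, hφ, hy, hxy⟩ := h.exists_subseq_of_arcJoinedMod (tendsto_const_nhds (x := x)) hb
  exact ⟨y, hxy, φ, hφ, hy⟩

/-- A countable family of clopen subsets of `S` that contains arbitrarily small neighbourhoods of
every class. -/
theorem exists_countable_isClopen [SecondCountableTopology X]
    (h : IsGappedParametrization g F L S) :
    ∃ 𝒱 : Set (Set S), 𝒱.Countable ∧ (∀ V ∈ 𝒱, IsClopen V) ∧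
      ∀ x : S, ∀ W : Set X, IsOpen W → (∀ y, ArcJoinedMod g F L (x : X) y → y ∈ W) →
        ∃ V ∈ 𝒱, x ∈ V ∧ Subtype.val '' V ⊆ W := by
  obtain ⟨𝓑, h𝓑c, -, h𝓑⟩ := exists_countable_basis X
  have hfin : {u : Set (Set X) | u.Finite ∧ u ⊆ 𝓑}.Countable :=
    countable_ofPred_finite_subset h𝓑c
  -- Classes are compact, so finite unions `u` of basic open sets suffice as their neighbourhoods.
  -- For each `u`, the Lindelöf property selects countably many of the clopen sets inside `⋃₀ u`.
  have hsel : ∀ u : Set (Set X), ∃ 𝒲 : Set (Set S), 𝒲.Countable ∧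
      𝒲 ⊆ {V | IsClopen V ∧ Subtype.val '' V ⊆ ⋃₀ u} ∧
      ⋃₀ 𝒲 = ⋃₀ {V : Set S | IsClopen V ∧ Subtype.val '' V ⊆ ⋃₀ u} := fun u =>
    isOpen_sUnion_countable _ fun V hV => hV.1.2
  choose 𝒲 h𝒲c h𝒲 h𝒲u using hsel
  refine ⟨⋃ u ∈ {u : Set (Set X) | u.Finite ∧ u ⊆ 𝓑}, 𝒲 u, hfin.biUnion fun u _ => h𝒲c u,
    ?_, ?_⟩
  · intro V hV
    obtain ⟨u, -, hV⟩ := mem_iUnion₂.1 hV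
    exact (h𝒲 u hV).1
  intro x W hW hxW
  obtain ⟨u, hu, hCu, huW⟩ : ∃ u : Set (Set X), (u.Finite ∧ u ⊆ 𝓑) ∧
      {y | ArcJoinedMod g F L (x : X) y} ⊆ ⋃₀ u ∧ ⋃₀ u ⊆ W := by
    obtain ⟨t, ht, htf, htc⟩ := (h.isCompact_class (x : X)).elim_finite_subcover_image
      (b := {B | B ∈ 𝓑 ∧ B ⊆ W}) (c := id) (fun B hB => h𝓑.isOpen hB.1) (by
        intro y hy
        obtain ⟨B, hB, hyB, hBW⟩ := h𝓑.exists_subset_of_mem_open (hxW y hy) hW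
        exact mem_biUnion (show B ∈ {B | B ∈ 𝓑 ∧ B ⊆ W} from ⟨hB, hBW⟩) hyB)
    exact ⟨t, ⟨htf, fun B hB => (ht hB).1⟩, by simpa [sUnion_eq_biUnion] using htc,
      sUnion_subset fun B hB => (ht hB).2⟩
  have huo : IsOpen (⋃₀ u) := isOpen_sUnion fun B hB => h𝓑.isOpen (hu.2 hB)
  obtain ⟨V, hV, hxV, hVu⟩ := h.exists_isClopen (x := x) (huo.preimage continuous_subtype_val)
    (fun y hy => hCu hy)
  have hmem : x ∈ ⋃₀ 𝒲 u := by
    rw [h𝒲u u]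
    exact ⟨V, ⟨hV, image_subset_iff.2 hVu⟩, hxV⟩
  obtain ⟨V', hV', hxV'⟩ := hmem
  exact ⟨V', mem_biUnion (show u ∈ {u : Set (Set X) | u.Finite ∧ u ⊆ 𝓑} from hu) hV', hxV',
    (h𝒲 u hV').2.trans huW⟩

end IsGappedParametrization

/-! ### The compactification -/

/-- A metrizable compactification in which the closures of countably many given pairs of disjoint
closed sets remain disjoint. -/
theorem exists_metrizable_compactification (X : Type u) [TopologicalSpace X] [MetrizableSpace X]
    [SecondCountableTopology X] {𝒜 : Set (Set X × Set X)} (h𝒜 : 𝒜.Countable)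
    (hcl : ∀ p ∈ 𝒜, IsClosed p.1 ∧ IsClosed p.2 ∧ Disjoint p.1 p.2) :
    ∃ (Y : Type v) (_ : TopologicalSpace Y) (e : X → Y), CompactSpace Y ∧ MetrizableSpace Y ∧
      IsEmbedding e ∧ DenseRange e ∧
      ∀ p ∈ 𝒜, Disjoint (closure (e '' p.1)) (closure (e '' p.2)) := by
  let _ := metrizableSpaceMetric X
  -- The dummy pair makes the family non-empty, hence enumerable by `ℕ`.
  obtain ⟨P, hP⟩ := (h𝒜.insert (∅, ∅)).exists_eq_range (insert_nonempty _ _)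
  have hP' : ∀ n, IsClosed (P n).1 ∧ IsClosed (P n).2 ∧ Disjoint (P n).1 (P n).2 := by
    intro n
    rcases hP.symm.subset (mem_range_self n) with h | h
    · rw [h]
      exact ⟨isClosed_empty, isClosed_empty, disjoint_bot_left⟩
    · exact hcl _ h
  obtain ⟨F, hF⟩ := Metric.PiNatEmbed.exists_embedding_to_hilbert_cube (X := X)
  choose f hf0 hf1 hf using fun n =>
    exists_continuous_zero_one_of_isClosed (hP' n).1 (hP' n).2.1 (hP' n).2.2
  -- The first factor embeds `X`; the coordinates of the second are Urysohn functions of the given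
  -- pairs, which thereby extend to the closure of the range.
  let G : X → (ℕ → unitInterval) × (ℕ → unitInterval) := fun x => (F x, fun n => ⟨f n x, hf n x⟩)
  have hGc : Continuous G := hF.continuous.prodMk
    (continuous_pi fun n => (f n).continuous.subtype_mk _)
  have hG : IsEmbedding G := IsEmbedding.of_comp hGc continuous_fst hF
  let Z := ↥(closure (range G))
  have hZc : CompactSpace Z := isCompact_iff_compactSpace.1 isClosed_closure.isCompact
  let e₀ : X → Z := fun x => ⟨G x, subset_closure (mem_range_self x)⟩
  have he₀ : IsEmbedding e₀ := hG.codRestrict _ _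
  have hd₀ : DenseRange e₀ := by
    intro z
    rw [closure_subtype, ← range_comp]
    exact z.2
  let e : X → ULift.{v} Z := fun x => ULift.up (e₀ x)
  have hup : IsEmbedding (ULift.up : Z → ULift.{v} Z) := Homeomorph.ulift.symm.isEmbedding
  refine ⟨ULift.{v} Z, inferInstance, e, inferInstance,
    (Homeomorph.ulift (X := Z)).isEmbedding.metrizableSpace, hup.comp he₀,
    (Homeomorph.ulift (X := Z)).symm.surjective.denseRange.comp hd₀ hup.continuous, ?_⟩
  intro p hp
  obtain ⟨n, rfl⟩ := hP.subset (Or.inr hp)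
  let q : ULift.{v} Z → ℝ := fun z => ((z.down : (ℕ → unitInterval) × (ℕ → unitInterval)).2 n : ℝ)
  have hq : Continuous q := by
    have h1 : Continuous fun z : ULift.{v} Z =>
        (z.down : (ℕ → unitInterval) × (ℕ → unitInterval)) :=
      continuous_subtype_val.comp continuous_uliftDown
    exact continuous_subtype_val.comp ((continuous_apply n).comp (continuous_snd.comp h1))
  have h0 : closure (e '' (P n).1) ⊆ q ⁻¹' {0} :=
    closure_minimal (by rintro _ ⟨x, hx, rfl⟩; exact hf0 n hx) (isClosed_singleton.preimage hq)
  have h1 : closure (e '' (P n).2) ⊆ q ⁻¹' {1} :=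
    closure_minimal (by rintro _ ⟨x, hx, rfl⟩; exact hf1 n hx) (isClosed_singleton.preimage hq)
  refine Disjoint.mono h0 h1 (disjoint_left.2 fun z hz hz' => ?_)
  rw [mem_preimage, mem_singleton_iff] at hz hz'
  exact zero_ne_one (hz.symm.trans hz')

theorem isArc_image_Icc {X : Type*} [TopologicalSpace X] [T2Space X] {g : ℝ → X} {s t : ℝ}
    (hst : s < t) (hg : ContinuousOn g (Icc s t)) (hi : InjOn g (Icc s t)) :
    IsArc (g '' Icc s t) := by
  let E : Icc s t ≃ g '' Icc s t := Equiv.Set.imageOfInjOn g _ hi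
  have hE : Continuous E := Continuous.subtype_mk (continuousOn_iff_continuous_domRestrict.1 hg) _
  exact ⟨(hE.homeoOfEquivCompactToT2).symm.trans (iccHomeoI s t hst)⟩

/-- The arc closure condition for arcs given by a parametrization. -/
theorem ArcClosureCondition.isCompact_closure {X : Type*} [TopologicalSpace X] [MetrizableSpace X]
    (hX : ArcClosureCondition X) {g : ℝ → X} {s t : ℕ → ℝ} {x : X} (hne : ∀ n, s n ≠ t n)
    (hg : ∀ n, ContinuousOn g (uIcc (s n) (t n))) (hi : ∀ n, InjOn g (uIcc (s n) (t n)))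
    (hs : Tendsto (g ∘ s) atTop (𝓝 x)) (hd : closure (⋃ n, g '' uIcc (s n) (t n)) ≠ univ) :
    IsCompact (closure (⋃ n, g '' uIcc (s n) (t n))) := by
  let A : ℕ → NonemptyCompacts X := fun n =>
    { carrier := g '' uIcc (s n) (t n)
      isCompact' := isCompact_uIcc.image_of_continuousOn (hg n)
      nonempty' := ⟨_, s n, left_mem_uIcc, rfl⟩ }
  exact (hX A (fun n => isArc_image_Icc (min_lt_max.2 (hne n)) (hg n) (hi n))
    ⟨g ∘ s, x, fun n => ⟨s n, left_mem_uIcc, rfl⟩, hs⟩).resolve_right hd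

section Construction

variable {X : Type u} [TopologicalSpace X] [MetrizableSpace X] {g : ℝ → X} {D : Set ℝ} {L : Set X}

/-- Gaps are parameters that either visit `U` or lie outside `D`. Thus a missing end of the line, or
a half absorbed by `L`, provides gaps for free. -/
theorem ArcClosureCondition.isGappedParametrization_compl (hX : ArcClosureCondition X)
    (hD : IsClosed D) (hg : ContinuousOn g D) (hi : InjOn g D) (hL : IsCompact L)
    (hLD : L ∪ g '' D = univ) {U : Set X} (hU : IsOpen U) (hne : U.Nonempty) (hUL : Disjoint U L)
    (hge : ∀ r, ∃ t ≥ r, t ∈ D → g t ∈ U) (hle : ∀ r, ∃ t ≤ r, t ∈ D → g t ∈ U) :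
    IsGappedParametrization g (D ∩ g ⁻¹' Uᶜ) L Uᶜ where
  isClosed_dom := hg.preimage_isClosed_of_isClosed hD hU.isClosed_compl
  isClosed := hU.isClosed_compl
  continuousOn := hg.mono inter_subset_left
  injOn := hi.mono inter_subset_left
  isCompact := hL
  union_eq := by
    rw [image_inter_preimage]
    ext x
    refine ⟨?_, fun hx => ?_⟩
    · rintro (hx | hx)
      · exact fun hxU => disjoint_left.1 hUL hxU hx
      · exact hx.2
    · exact (hLD.symm.subset (mem_univ x)).imp id fun h => ⟨h, hx⟩
  exists_ge r := (hge r).imp fun t ht => ⟨ht.1, fun h => h.2 (ht.2 h.1)⟩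
  exists_le r := (hle r).imp fun t ht => ⟨ht.1, fun h => h.2 (ht.2 h.1)⟩
  isCompact_closure s t x hst hF hs := by
    refine hX.isCompact_closure hst (fun n => hg.mono ((hF n).trans inter_subset_left))
      (fun n => hi.mono ((hF n).trans inter_subset_left)) hs fun huniv => ?_
    obtain ⟨p, hp⟩ := hne
    have hsub : closure (⋃ n, g '' uIcc (s n) (t n)) ⊆ Uᶜ :=
      closure_minimal (iUnion_subset fun n => by
        rintro _ ⟨r, hr, rfl⟩
        exact (hF n hr).2) hU.isClosed_compl
    exact hsub (huniv ▸ mem_univ p) hp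

/-- A metrizable compactification of `X` in which no proper subcontinuum meets both `X` and its
remainder. -/
theorem ArcClosureCondition.exists_compactification [SecondCountableTopology X]
    (hX : ArcClosureCondition X) (hD : IsClosed D) (hg : ContinuousOn g D) (hi : InjOn g D)
    (hL : IsCompact L) (hL₀ : interior L = ∅) (hLD : L ∪ g '' D = univ)
    (hge : ∀ U : Set X, IsOpen U → U.Nonempty → ∀ r, ∃ t ≥ r, t ∈ D → g t ∈ U)
    (hle : ∀ U : Set X, IsOpen U → U.Nonempty → ∀ r, ∃ t ≤ r, t ∈ D → g t ∈ U) :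
    ∃ (Y : Type v) (_ : TopologicalSpace Y) (e : X → Y), CompactSpace Y ∧ MetrizableSpace Y ∧
      IsEmbedding e ∧ DenseRange e ∧ ∀ K : Set Y, IsSubcontinuum K → K ≠ univ →
        (K ∩ range e).Nonempty → K ⊆ range e := by
  obtain ⟨𝓑, h𝓑c, -, h𝓑⟩ := exists_countable_basis X
  have hgap : ∀ U : {U : Set X | U ∈ 𝓑 ∧ U.Nonempty ∧ Disjoint U L},
      IsGappedParametrization g (D ∩ g ⁻¹' (U : Set X)ᶜ) L (U : Set X)ᶜ := fun U =>
    have hU := h𝓑.isOpen U.2.1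
    hX.isGappedParametrization_compl hD hg hi hL hLD hU U.2.2.1 U.2.2.2 (hge _ hU U.2.2.1)
      (hle _ hU U.2.2.1)
  choose 𝒱 h𝒱c h𝒱 hsmall using fun U => (hgap U).exists_countable_isClopen
  have : Countable {U : Set X | U ∈ 𝓑 ∧ U.Nonempty ∧ Disjoint U L} :=
    (h𝓑c.mono fun U hU => hU.1).to_subtype
  obtain ⟨Y, hY, e, hYc, hYm, he, hde, hsep⟩ := exists_metrizable_compactification X
    (𝒜 := ⋃ U, (fun V => (Subtype.val '' V, Subtype.val '' Vᶜ)) '' 𝒱 U)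
    (countable_iUnion fun U => (h𝒱c U).image _) (by
      intro p hp
      obtain ⟨U, V, hV, rfl⟩ := mem_iUnion.1 hp
      have hcm := (hgap U).isClosed.isClosedEmbedding_subtypeVal.isClosedMap
      exact ⟨hcm _ (h𝒱 U V hV).1, hcm _ (h𝒱 U V hV).compl.1,
        disjoint_image_of_injective Subtype.val_injective disjoint_compl_right⟩)
  refine ⟨Y, hY, e, hYc, hYm, he, hde, fun K ⟨hK, hKc⟩ hKu hKe => ?_⟩
  have hO : IsOpen (e ⁻¹' Kᶜ) := hKc.isClosed.isOpen_compl.preimage he.continuous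
  -- Emptiness of the interior of `L` leaves room for a basic `U` around `p` that avoids both `L`
  -- and, with its closure in `Y`, the continuum `K`.
  obtain ⟨p, hpO, hpL⟩ : ∃ p ∈ e ⁻¹' Kᶜ, p ∉ L := by
    obtain ⟨x, hx⟩ := hde.exists_mem_open hKc.isClosed.isOpen_compl (nonempty_compl.2 hKu)
    by_contra! hcon
    exact (hL₀ ▸ interior_maximal hcon hO hx : x ∈ (∅ : Set X))
  obtain ⟨O', hO', hpO', hO'K⟩ := normal_exists_closure_subset (isClosed_singleton (x := e p))
    hKc.isClosed.isOpen_compl (singleton_subset_iff.2 hpO)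
  obtain ⟨U, hU𝓑, hpU, hU⟩ := h𝓑.exists_subset_of_mem_open
    (show p ∈ e ⁻¹' O' ∩ Lᶜ from ⟨hpO' rfl, hpL⟩)
    ((hO'.preimage he.continuous).inter hL.isClosed.isOpen_compl)
  let U' : {U : Set X | U ∈ 𝓑 ∧ U.Nonempty ∧ Disjoint U L} :=
    ⟨U, hU𝓑, ⟨p, hpU⟩, disjoint_left.2 fun x hx => (hU hx).2⟩
  have hKU : K ⊆ closure (e '' Uᶜ) := by
    intro z hz
    have h1 : z ∈ (closure O')ᶜ := fun h => hO'K h hz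
    refine closure_mono ?_ (hde.open_subset_closure_inter isClosed_closure.isOpen_compl h1)
    rintro _ ⟨hx, x, rfl⟩
    exact ⟨x, fun hxU => hx (subset_closure (hU hxU).1), rfl⟩
  obtain ⟨_, hxK, x, rfl⟩ := hKe
  have hxU : x ∈ Uᶜ := fun h => hO'K (subset_closure (hU h).1) hxK
  have hC := ((hgap U').isCompact_class x).image he.continuous
  -- The target is the image of the class of `x`. A point `y ∈ K` outside it would be cut off by a
  -- clopen `V` around the class, whose closure and that of its complement cover `K`.
  refine Subset.trans ?_ (image_subset_range e {y | ArcJoinedMod g (D ∩ g ⁻¹' Uᶜ) L x y})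
  intro y hyK
  by_contra hyC
  obtain ⟨N, N', hN, hN', hCN, hyN', hNN'⟩ := SeparatedNhds.of_isCompact_isCompact hC
    (isCompact_singleton (x := y)) (disjoint_singleton_right.2 hyC)
  obtain ⟨V, hV, hxV, hVN⟩ := hsmall U' ⟨x, hxU⟩ (e ⁻¹' N) (hN.preimage he.continuous)
    fun z hz => hCN ⟨z, hz, rfl⟩
  have hd := hsep _ (mem_iUnion.2 ⟨U', V, hV, rfl⟩)
  have hcov : K ⊆ closure (e '' (Subtype.val '' V)) ∪ closure (e '' (Subtype.val '' Vᶜ)) := by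
    rw [← closure_union, ← image_union, ← image_union, union_compl_self, image_univ,
      Subtype.range_coe]
    exact hKU
  rcases isPreconnected_iff_subset_of_disjoint_closed.1 hK.isPreconnected _ _ isClosed_closure
    isClosed_closure hcov (by rw [hd.inter_eq, inter_empty]) with h | h
  · have hyN : y ∈ closure N := closure_mono (image_subset_iff.2 hVN) (h hyK)
    obtain ⟨w, hw', hw⟩ := mem_closure_iff.1 hyN N' hN' (hyN' rfl)
    exact disjoint_left.1 hNN' hw hw'
  · exact disjoint_left.1 hd (subset_closure ⟨x, ⟨⟨x, hxU⟩, hxV, rfl⟩, rfl⟩) (h hxK)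

end Construction

/-- A dense subspace without compact subsets with interior, whose points are joined by continua,
is a composant if no proper subcontinuum meets both it and its complement. -/
theorem isIndecomposableComposant_of_compactification {X : Type u}
    [TopologicalSpace X] {Y : Type v} [TopologicalSpace Y]
    [CompactSpace Y] [MetrizableSpace Y] [Nonempty X] {e : X → Y} (he : IsEmbedding e)
    (hde : DenseRange e) (hK : ∀ K : Set Y, IsSubcontinuum K → K ≠ univ →
      (K ∩ range e).Nonempty → K ⊆ range e) (hX : ¬ CompactSpace X)
    (hconn : ∀ x y : X, ∃ T, IsCompact T ∧ IsConnected T ∧ x ∈ T ∧ y ∈ T) :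
    IsIndecomposableComposant.{u, v} X := by
  have hXconn : ConnectedSpace X :=
    { isPreconnected_univ := isPreconnected_of_forall_pair fun x _ y _ => by
        obtain ⟨T, -, hT, hx, hy⟩ := hconn x y
        exact ⟨T, subset_univ _, hx, hy, hT.isPreconnected⟩
      toNonempty := inferInstance }
  refine ⟨Y, inferInstance, e, ⟨⟨?_, inferInstance, inferInstance⟩, ?_⟩, he, ?_⟩
  · have hYp : PreconnectedSpace Y := hde.preconnectedSpace he.continuous
    exact { toNonempty := ⟨e (Classical.arbitrary X)⟩ }
  · rintro ⟨H, K, hH, hK', hHu, hKu, hHK⟩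
    have key : ∀ H K : Set Y, IsSubcontinuum H → IsSubcontinuum K → H ≠ univ → K ≠ univ →
        H ∪ K = univ → H ⊆ range e := by
      intro H K hH hK' hHu hKu hHK
      refine hK H hH hHu ?_
      obtain ⟨x, hx⟩ := hde.exists_mem_open hK'.2.isClosed.isOpen_compl (nonempty_compl.2 hKu)
      exact ⟨e x, (hHK.symm.subset (mem_univ _)).resolve_right hx, x, rfl⟩
    have hr : range e = univ := univ_subset_iff.1 (hHK ▸ union_subset (key H K hH hK' hHu hKu hHK)
      (key K H hK' hH hKu hHu (union_comm H K ▸ hHK)))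
    refine hX ⟨?_⟩
    rw [he.isCompact_iff, image_univ, hr]
    exact isCompact_univ
  · obtain ⟨x₀⟩ := ‹Nonempty X›
    refine ⟨e x₀, mem_range_self x₀, subset_antisymm ?_ ?_⟩
    · rintro _ ⟨x, rfl⟩
      obtain ⟨T, hTc, hT, hx₀, hx⟩ := hconn x₀ x
      refine ⟨e '' T, ⟨⟨hT.image e he.continuous.continuousOn, hTc.image he.continuous⟩, ?_,
        x₀, hx₀, rfl⟩, x, hx, rfl⟩
      intro hu
      refine hX ⟨?_⟩
      convert hTc
      refine (eq_univ_of_forall fun z => ?_).symm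
      obtain ⟨w, hw, hwz⟩ := hu.symm.subset (mem_univ (e z))
      exact he.injective hwz ▸ hw
    · rintro y ⟨K, ⟨hKs, hKu, hxK⟩, hyK⟩
      exact hK K hKs hKu ⟨e x₀, hxK, x₀, rfl⟩ hyK

/-! ### Necessity: composants of indecomposable continua -/

theorem exists_frequently_eq_or_tendsto_atTop (n : ℕ → ℕ) :
    (∃ m, ∃ᶠ k in atTop, n k = m) ∨ Tendsto n atTop atTop := by
  by_cases h : ∃ m, ∃ᶠ k in atTop, n k = m
  · exact Or.inl h
  · push Not at h
    right
    rw [← Nat.cofinite_eq_atTop]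
    rw [← Nat.cofinite_eq_atTop] at h
    exact le_cofinite_iff_eventually_ne.2 fun m => h m

section IndecomposableContinuum

variable {Y : Type*} [TopologicalSpace Y]

/-- A non-degenerate composant is dense. -/
theorem dense_composant [T4Space Y] [CompactSpace Y] [PreconnectedSpace Y] {x : Y}
    (hx : x ∈ composant x) : Dense (composant x) := by
  intro z
  by_contra hz
  obtain ⟨V, hV, hzV, hVU⟩ := normal_exists_closure_subset (isClosed_singleton (x := z))
    (isClosed_closure (s := composant x)).isOpen_compl (singleton_subset_iff.2 hz)
  have hxV : x ∈ Vᶜ := fun h => hVU (subset_closure h) (subset_closure hx)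
  -- Growing a continuum from `x` until it touches `closure V` keeps it proper, as it misses `z`,
  -- yet leads out of the closure of the composant.
  obtain ⟨C, hC, hCc, hCconn, hxC, w, hwC, hw⟩ :=
    isPreconnected_univ.exists_isConnected_inter_closure_compl_nonempty isCompact_univ
      (mem_univ x) hV.isClosed_compl hxV (fun h => h (mem_univ z) (hzV rfl))
  rw [compl_compl] at hw
  refine hVU hw (subset_closure ⟨C, ⟨⟨hCconn, hCc⟩, fun hu => ?_, hxC⟩, hwC⟩)
  exact (hC (hu.symm.subset (mem_univ z))).2 (hzV rfl)

theorem IsIndecomposableContinuum.union_ne_univ (hY : IsIndecomposableContinuum Y) {H K : Set Y}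
    (hH : IsSubcontinuum H) (hK : IsSubcontinuum K) (hHu : H ≠ univ) (hKu : K ≠ univ) :
    H ∪ K ≠ univ := fun h => hY.2 ⟨H, K, hH, hK, hHu, hKu, h⟩

/-- A proper subcontinuum that meets a composant lies in it. -/
theorem IsIndecomposableContinuum.subset_composant (hY : IsIndecomposableContinuum Y) {x : Y}
    {K : Set Y} (hK : IsSubcontinuum K) (hKu : K ≠ univ) (hne : (K ∩ composant x).Nonempty) :
    K ⊆ composant x := by
  obtain ⟨p, hpK, H, ⟨hH, hHu, hxH⟩, hpH⟩ := hne
  intro y hy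
  exact ⟨H ∪ K, ⟨⟨hH.1.union ⟨p, hpH, hpK⟩ hK.1, hH.2.union hK.2⟩,
    hY.union_ne_univ hH hK hHu hKu, Or.inl hxH⟩, Or.inr hy⟩

end IndecomposableContinuum

/-- A composant of an indecomposable continuum satisfies the arc closure condition. -/
theorem IsIndecomposableComposant.arcClosureCondition {X : Type u} [TopologicalSpace X]
    (hX : IsIndecomposableComposant.{u, v} X) : ArcClosureCondition X := by
  obtain ⟨Y, _, e, hY, he, x₀, -, hx₀⟩ := hX
  obtain ⟨-, hYc, hYm⟩ := hY.1
  rintro A hA ⟨x, p, hx, hp⟩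
  refine or_iff_not_imp_right.2 fun hd => ?_
  have hcl : closure (⋃ n, (A n : Set X)) = e ⁻¹' closure (e '' ⋃ n, (A n : Set X)) :=
    he.isInducing.closure_eq_preimage_closure_image _
  have hQ : closure (e '' ⋃ n, (A n : Set X)) ≠ univ := fun h => hd (by rw [hcl, h, preimage_univ])
  have hAc : ∀ n, IsConnected (A n : Set X) := by
    intro n
    obtain ⟨φ⟩ := hA n
    have : ConnectedSpace (Icc (0 : ℝ) 1) :=
      isConnected_iff_connectedSpace.1 (isConnected_Icc zero_le_one)
    exact isConnected_iff_connectedSpace.2 (φ.symm.surjective.connectedSpace φ.symm.continuous)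
  have hsub : closure (e '' ⋃ n, (A n : Set X)) ⊆ range e := by
    intro y hy
    obtain ⟨b, hb, hby⟩ := mem_closure_iff_seq_limit.1 hy
    have hb' : ∀ k, ∃ n, b k ∈ e '' (A n : Set X) := by
      intro k
      obtain ⟨z, hz, hzb⟩ := hb k
      obtain ⟨n, hn⟩ := mem_iUnion.1 hz
      exact ⟨n, z, hn, hzb⟩
    choose n hn using hb'
    -- Either one arc, which is compact, contains infinitely many `b k`, or the indices tend to
    -- infinity. In the latter case the selections still tend to `p`, and a proper limit continuum
    -- joins `e p` to `y`.
    rcases exists_frequently_eq_or_tendsto_atTop n with ⟨m, hm⟩ | hn'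
    · have hm' : ∃ᶠ k in atTop, b k ∈ e '' (A m : Set X) := hm.mono fun k hk => hk ▸ hn k
      have hcm : IsClosed (e '' (A m : Set X)) := ((A m).isCompact.image he.continuous).isClosed
      exact image_subset_range e _ (hcm.closure_subset
        (mem_closure_of_frequently_of_tendsto hm' hby))
    · obtain ⟨T, hT, hTc, hTconn, hpT, hyT⟩ :=
        (isCompact_univ (X := Y)).exists_isConnected_of_tendsto
          (A := fun k => e '' (A (n k) : Set X))
          (fun k => ((hAc (n k)).image e he.continuous.continuousOn).isPreconnected)
          (fun k => subset_univ _) (fun k => ⟨x (n k), hx (n k), rfl⟩) hn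
          ((he.continuous.tendsto p).comp (hp.comp hn')) hby
      have hTQ : T ⊆ closure (e '' ⋃ n, (A n : Set X)) := hT.trans (closure_mono
        (iUnion_subset fun k => image_mono (subset_iUnion (fun n => (A n : Set X)) (n k))))
      rw [hx₀]
      refine hY.subset_composant ⟨hTconn, hTc⟩ (fun h => hQ (univ_subset_iff.1 (h ▸ hTQ)))
        ⟨e p, hpT, ?_⟩ hyT
      rw [← hx₀]
      exact mem_range_self p
  rw [he.isCompact_iff, hcl, image_preimage_eq_of_subset hsub]
  exact isClosed_closure.isCompact

/-- A parametrization of a composant of an indecomposable continuum is recurrent. -/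
theorem IsIndecomposableComposant.closure_image_eq_univ {X : Type u} [TopologicalSpace X]
    (hX : IsIndecomposableComposant.{u, v} X) {ℓ : Set ℝ} {g : ℝ → X} (hℓ : Ici 0 ⊆ ℓ)
    (hℓc : IsClosed ℓ)
    (hℓo : ℓ.OrdConnected) (hg : ContinuousOn g ℓ) (hi : InjOn g ℓ) (hs : g '' ℓ = univ) (n : ℕ) :
    closure (g '' (ℓ ∩ Ici (n : ℝ))) = univ ∨ closure (g '' (ℓ ∩ Iic (-(n : ℝ)))) = univ := by
  obtain ⟨Y, _, e, hY, he, x₀, hx₀r, hx₀⟩ := hX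
  obtain ⟨hYconn, hYc, hYm⟩ := hY.1
  have hde : Dense (range e) := hx₀ ▸ dense_composant (hx₀ ▸ hx₀r)
  have hcl : ∀ A : Set ℝ, closure (e '' (g '' A)) = univ → closure (g '' A) = univ := fun A hA => by
    rw [he.isInducing.closure_eq_preimage_closure_image, hA, preimage_univ]
  have hsc : ∀ A : Set ℝ, A ⊆ ℓ → A.OrdConnected → A.Nonempty →
      IsSubcontinuum (closure (e '' (g '' A))) := by
    intro A hA hAo hne
    have hAc : IsConnected A := ⟨hne, hAo.isPreconnected⟩
    exact ⟨((hAc.image g (hg.mono hA)).image e he.continuous.continuousOn).closure,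
      isClosed_closure.isCompact⟩
  have hn0 : (0 : ℝ) ≤ n := n.cast_nonneg
  have hnℓ : (n : ℝ) ∈ ℓ := hℓ hn0
  have hH := hsc (ℓ ∩ Ici (n : ℝ)) inter_subset_left (hℓo.inter ordConnected_Ici)
    ⟨n, hnℓ, self_mem_Ici⟩
  have hM := hsc (ℓ ∩ Icc (-(n : ℝ)) n) inter_subset_left (hℓo.inter ordConnected_Icc)
    ⟨n, hnℓ, by simp [hn0]⟩
  by_contra! hcon
  have hHu := fun h => hcon.1 (hcl _ h)
  have hKu := fun h => hcon.2 (hcl _ h)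
  -- The middle segment is compact, hence already closed, and omits the point with parameter `n +
  -- 1`.
  have hMu : closure (e '' (g '' (ℓ ∩ Icc (-(n : ℝ)) n))) ≠ univ := by
    intro hu
    have hc : IsClosed (e '' (g '' (ℓ ∩ Icc (-(n : ℝ)) n))) :=
      (((isCompact_Icc.inter_left hℓc).image_of_continuousOn
        (hg.mono inter_subset_left)).image he.continuous).isClosed
    rw [hc.closure_eq] at hu
    obtain ⟨_, ⟨t, ht, rfl⟩, hte⟩ := hu.symm.subset (mem_univ (e (g ((n : ℝ) + 1))))
    have : t = (n : ℝ) + 1 := hi ht.1 (hℓ (mem_Ici.2 (by positivity))) (he.injective hte)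
    have := ht.2.2
    linarith
  have hnM : (n : ℝ) ∈ ℓ ∩ Icc (-(n : ℝ)) n := ⟨hnℓ, by simp [hn0]⟩
  have hnH : (n : ℝ) ∈ ℓ ∩ Ici (n : ℝ) := ⟨hnℓ, self_mem_Ici⟩
  have hMH := hM.1.union ⟨e (g n), subset_closure (mem_image_of_mem e (mem_image_of_mem g hnM)),
    subset_closure (mem_image_of_mem e (mem_image_of_mem g hnH))⟩ hH.1
  have hMHu := hY.union_ne_univ hM hH hMu hHu
  have hcov : (closure (e '' (g '' (ℓ ∩ Icc (-(n : ℝ)) n))) ∪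
      closure (e '' (g '' (ℓ ∩ Ici (n : ℝ))))) ∪
      closure (e '' (g '' (ℓ ∩ Iic (-(n : ℝ))))) = univ := by
    rw [← closure_union, ← closure_union, ← univ_subset_iff, ← hde.closure_eq]
    refine closure_mono ?_
    rintro _ ⟨x, rfl⟩
    obtain ⟨t, ht, rfl⟩ := hs.symm.subset (mem_univ x)
    rcases le_total t (-(n : ℝ)) with h1 | h1
    · exact Or.inr ⟨_, ⟨t, ⟨ht, h1⟩, rfl⟩, rfl⟩
    rcases le_total t n with h2 | h2
    · exact Or.inl (Or.inl ⟨_, ⟨t, ⟨ht, h1, h2⟩, rfl⟩, rfl⟩)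
    · exact Or.inl (Or.inr ⟨_, ⟨t, ⟨ht, h2⟩, rfl⟩, rfl⟩)
  -- On the half-line the initial segment is empty for `n ≥ 1`, hence no continuum.
  rcases (ℓ ∩ Iic (-(n : ℝ))).eq_empty_or_nonempty with hemp | hne
  · rw [hemp, image_empty, image_empty, closure_empty, union_empty] at hcov
    exact hMHu hcov
  · exact hY.union_ne_univ ⟨hMH, hM.2.union hH.2⟩
      (hsc _ inter_subset_left (hℓo.inter ordConnected_Iic) hne) hMHu hKu hcov

/-! ### Equivalence of the two arc conditions -/

/-- The two compactness conditions on sequences of arcs are equivalent. -/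
theorem arcClosureCondition_iff_arcSubsequenceCondition (X : Type*) [TopologicalSpace X]
    [MetrizableSpace X] : ArcClosureCondition X ↔ ArcSubsequenceCondition X := by
  let _ := metrizableSpaceMetric X
  constructor
  · intro h A hA hx hd
    let Q := closure (⋃ n, (A n : Set X))
    have hQ : CompactSpace Q := isCompact_iff_compactSpace.1 ((h A hA hx).resolve_right hd)
    have hAQ : ∀ n, (A n : Set X) ⊆ Q := fun n =>
      (subset_iUnion (fun n => (A n : Set X)) n).trans subset_closure
    -- Regarded inside the compact closure `Q`, the arcs form a sequence in a compact hyperspace.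
    let B : ℕ → NonemptyCompacts Q := fun n =>
      { carrier := Subtype.val ⁻¹' (A n : Set X)
        isCompact' := isClosed_closure.isClosedEmbedding_subtypeVal.isCompact_preimage
          (A n).isCompact
        nonempty' := (A n).nonempty.elim fun x hx => ⟨⟨x, hAQ n hx⟩, hx⟩ }
    have hB : ∀ n, (B n).map Subtype.val continuous_subtype_val = A n := by
      intro n
      ext1
      change Subtype.val '' (Subtype.val ⁻¹' (A n : Set X)) = A n
      rw [Subtype.image_preimage_coe, inter_eq_right]
      exact hAQ n
    obtain ⟨K, φ, hφ, hK⟩ := CompactSpace.tendsto_subseq B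
    refine ⟨φ, K.map Subtype.val continuous_subtype_val, hφ, ?_⟩
    have := ((continuous_subtype_val (p := (· ∈ Q))).nonemptyCompacts_map.tendsto K).comp hK
    exact this.congr fun k => hB (φ k)
  · rintro h A hA ⟨x, p, hx, hp⟩
    refine or_iff_not_imp_right.2 fun hd => IsSeqCompact.isCompact fun z hz => ?_
    have hy : ∀ k : ℕ, ∃ y ∈ ⋃ n, (A n : Set X), dist (z k) y < 1 / ((k : ℝ) + 1) := fun k =>
      Metric.mem_closure_iff.1 (hz k) _ (by positivity)
    choose y hyA hyz using hy
    choose n hn using fun k => mem_iUnion.1 (hyA k)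
    suffices H : ∃ (w : X) (φ : ℕ → ℕ), StrictMono φ ∧ Tendsto (y ∘ φ) atTop (𝓝 w) by
      obtain ⟨w, φ, hφ, hw⟩ := H
      refine ⟨w, mem_closure_of_tendsto hw (Eventually.of_forall fun k => hyA (φ k)), φ, hφ, ?_⟩
      refine hw.congr_dist ?_
      refine squeeze_zero (fun _ => dist_nonneg) (fun k => ?_)
        ((tendsto_one_div_add_atTop_nhds_zero_nat (𝕜 := ℝ)).comp hφ.tendsto_atTop)
      rw [dist_comm]
      exact (hyz (φ k)).le
    rcases exists_frequently_eq_or_tendsto_atTop n with ⟨m, hm⟩ | hn'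
    · obtain ⟨φ, hφ, hφm⟩ := extraction_of_frequently_atTop hm
      obtain ⟨w, -, ψ, hψ, hw⟩ := (A m).isCompact.tendsto_subseq
        (x := y ∘ φ) (fun k => hφm k ▸ hn (φ k))
      exact ⟨w, φ ∘ ψ, hφ.comp hψ, hw⟩
    have hsub : closure (⋃ k, (A (n k) : Set X)) ⊆ closure (⋃ n, (A n : Set X)) :=
      closure_mono (iUnion_subset fun k => subset_iUnion (fun n => (A n : Set X)) (n k))
    obtain ⟨φ, K, hφ, hK⟩ := h (fun k => A (n k)) (fun k => hA (n k))
      ⟨fun k => x (n k), p, fun k => hx (n k), hp.comp hn'⟩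
      (fun hu => hd (univ_subset_iff.1 (hu ▸ hsub)))
    -- Nearest points in the limit `K`: Vietoris convergence sends their distance to `y (φ k)` to
    -- zero, and compactness of `K` yields the subsequence.
    choose v hvK hv using fun k =>
      K.isCompact.exists_infDist_eq_dist K.nonempty (y (φ k))
    have hlim : Tendsto (fun k => dist (v k) (y (φ k))) atTop (𝓝 0) := by
      rw [Metric.tendsto_atTop]
      intro ε hε
      have hev := hK.eventually ((NonemptyCompacts.isOpen_subsets_of_isOpen
        (Metric.isOpen_thickening (δ := ε) (E := (K : Set X)))).mem_nhds
          (Metric.self_subset_thickening hε _))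
      obtain ⟨N, hN⟩ := eventually_atTop.1 hev
      refine ⟨N, fun k hk => ?_⟩
      have := (Metric.mem_thickening_iff_infDist_lt K.nonempty).1 (hN k hk (hn (φ k)))
      rwa [Real.dist_0_eq_abs, abs_of_nonneg dist_nonneg, dist_comm, ← hv k]
    obtain ⟨w, -, ψ, hψ, hw⟩ := K.isCompact.tendsto_subseq hvK
    exact ⟨w, φ ∘ ψ, hφ.comp hψ, hw.congr_dist (hlim.comp hψ.tendsto_atTop)⟩

/-! ### Sufficiency: recurrence and the choice of `D` and `L` -/

/-- In a union of countably many closed sets with empty interior, compact sets have empty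
interior. -/
theorem IsCompact.interior_eq_empty_of_iUnion {X : Type*} [TopologicalSpace X] [T2Space X]
    {Q : Set X} (hQ : IsCompact Q) {K : ℕ → Set X} (hK : ∀ n, IsClosed (K n))
    (hKi : ∀ n, interior (K n) = ∅) (hKu : ⋃ n, K n = univ) : interior Q = ∅ := by
  by_contra hne
  obtain ⟨x, hx⟩ := nonempty_iff_ne_empty.2 hne
  have : CompactSpace Q := isCompact_iff_compactSpace.1 hQ
  -- Baire's theorem is applied in the compact space `Q`, as `X` itself need not be a Baire space.
  have hd := dense_iUnion_interior_of_closed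
    (fun n => (hK n).preimage (continuous_subtype_val (p := (· ∈ Q))))
    (by rw [← preimage_iUnion, hKu, preimage_univ])
  obtain ⟨z, hz, hzQ⟩ := hd.exists_mem_open (isOpen_interior.preimage continuous_subtype_val)
    (⟨⟨x, interior_subset hx⟩, hx⟩ : (Subtype.val ⁻¹' interior Q : Set Q).Nonempty)
  obtain ⟨n, hn⟩ := mem_iUnion.1 hz
  obtain ⟨_, hO, ⟨O, hOo, rfl⟩, hzO⟩ := mem_interior.1 hn
  have hsub : O ∩ interior Q ⊆ K n := fun w hw =>
    hO (show (⟨w, interior_subset hw.2⟩ : Q) ∈ Subtype.val ⁻¹' O from hw.1)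
  exact (hKi n).subset (interior_maximal hsub (hOo.inter isOpen_interior) ⟨hzO, hzQ⟩)

theorem exists_mem_of_closure_image_eq_univ {X : Type*} [TopologicalSpace X] {g : ℝ → X} {A : Set ℝ}
    (h : closure (g '' A) = univ) {U : Set X} (hU : IsOpen U) (hne : U.Nonempty) :
    ∃ t ∈ A, g t ∈ U := by
  obtain ⟨_, hxU, t, ht, rfl⟩ := (dense_iff_closure_eq.2 h).inter_open_nonempty U hU hne
  exact ⟨t, ht, hxU⟩

section Parametrization

variable {X : Type u} [TopologicalSpace X] [MetrizableSpace X] {g : ℝ → X} {ℓ : Set ℝ}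

/-- The image of a closed order-connected set of reals under a recurrent injective map has no
compact subsets with interior. -/
theorem IsCompact.interior_eq_empty_of_recurrent (hℓc : IsClosed ℓ) (hg : ContinuousOn g ℓ)
    (hi : InjOn g ℓ) (hs : g '' ℓ = univ)
    (hr : ∀ n : ℕ, closure (g '' (ℓ ∩ Ici (n : ℝ))) = univ ∨
      closure (g '' (ℓ ∩ Iic (-(n : ℝ)))) = univ) {Q : Set X} (hQ : IsCompact Q) :
    interior Q = ∅ := by
  refine hQ.interior_eq_empty_of_iUnion (K := fun n : ℕ => g '' (ℓ ∩ Icc (-(n : ℝ)) n))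
    (fun n => ((isCompact_Icc.inter_left hℓc).image_of_continuousOn
      (hg.mono inter_subset_left)).isClosed) (fun n => ?_) ?_
  -- A segment with interior would be revisited by parameters beyond `n + 1` in absolute value,
  -- against injectivity.
  · by_contra hne
    have hne' := nonempty_iff_ne_empty.2 hne
    obtain ⟨t, htℓ, ht, htU⟩ : ∃ t ∈ ℓ, t ∉ Icc (-(n : ℝ)) n ∧
        g t ∈ interior (g '' (ℓ ∩ Icc (-(n : ℝ)) n)) := by
      rcases hr (n + 1) with h | h
      · obtain ⟨t, ht, htU⟩ := exists_mem_of_closure_image_eq_univ h isOpen_interior hne'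
        refine ⟨t, ht.1, fun hm => ?_, htU⟩
        have h1 := mem_Ici.1 ht.2
        push_cast at h1
        linarith [hm.2]
      · obtain ⟨t, ht, htU⟩ := exists_mem_of_closure_image_eq_univ h isOpen_interior hne'
        refine ⟨t, ht.1, fun hm => ?_, htU⟩
        have h1 := mem_Iic.1 ht.2
        push_cast at h1
        linarith [hm.1]
    obtain ⟨s, hs', hst⟩ := interior_subset htU
    exact ht (hi hs'.1 htℓ hst ▸ hs'.2)
  · refine eq_univ_of_forall fun x => ?_
    obtain ⟨t, ht, rfl⟩ := hs.symm.subset (mem_univ x)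
    obtain ⟨n, hn⟩ := exists_nat_ge |t|
    exact mem_iUnion.2 ⟨n, t, ⟨ht, abs_le.1 hn⟩, rfl⟩

theorem ArcClosureCondition.isIndecomposableComposant (hX : ArcClosureCondition X)
    (hℓ : ℓ = Ici 0 ∨ ℓ = univ) (hg : ContinuousOn g ℓ) (hi : InjOn g ℓ) (hs : g '' ℓ = univ)
    (hr : ∀ n : ℕ, closure (g '' (ℓ ∩ Ici (n : ℝ))) = univ ∨
      closure (g '' (ℓ ∩ Iic (-(n : ℝ)))) = univ) :
    IsIndecomposableComposant.{u, v} X := by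
  have hℓc : IsClosed ℓ := by
    rcases hℓ with rfl | rfl
    exacts [isClosed_Ici, isClosed_univ]
  have hℓo : ℓ.OrdConnected := by
    rcases hℓ with rfl | rfl
    exacts [ordConnected_Ici, ordConnected_univ]
  have h0 : (0 : ℝ) ∈ ℓ := by rcases hℓ with rfl | rfl <;> simp
  have hne : Nonempty X := ⟨g 0⟩
  have hsec : SecondCountableTopology X := by
    let _ := metrizableSpaceMetric X
    have : IsSeparable (univ : Set X) := hs ▸ hg.isSeparable_image (.of_separableSpace ℓ)
    have : SeparableSpace X := isSeparable_univ_iff.1 this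
    exact UniformSpace.secondCountable_of_separable X
  have hint := fun {Q : Set X} => IsCompact.interior_eq_empty_of_recurrent (Q := Q) hℓc hg hi hs hr
  have hncomp : ¬ CompactSpace X := fun _ => by
    have := hint (isCompact_univ (X := X))
    rw [interior_univ] at this
    exact empty_ne_univ this.symm
  -- `D` carries the recurrent ends and `L` absorbs a non-recurrent half of the line, being empty in
  -- the other cases.
  suffices H : ∃ D ⊆ ℓ, ∃ L : Set X, IsClosed D ∧ IsCompact L ∧ L ∪ g '' D = univ ∧
      (∀ U : Set X, IsOpen U → U.Nonempty → ∀ r, ∃ t ≥ r, t ∈ D → g t ∈ U) ∧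
      (∀ U : Set X, IsOpen U → U.Nonempty → ∀ r, ∃ t ≤ r, t ∈ D → g t ∈ U) by
    obtain ⟨D, hDℓ, L, hD, hL, hLD, hge, hle⟩ := H
    obtain ⟨Y, _, e, _, _, he, hde, hK⟩ := hX.exists_compactification hD (hg.mono hDℓ)
      (hi.mono hDℓ) hL (hint hL) hLD hge hle
    refine isIndecomposableComposant_of_compactification he hde hK hncomp fun x y => ?_
    obtain ⟨s, hsℓ, rfl⟩ := hs.symm.subset (mem_univ x)
    obtain ⟨t, htℓ, rfl⟩ := hs.symm.subset (mem_univ y)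
    have hst : uIcc s t ⊆ ℓ := hℓo.uIcc_subset hsℓ htℓ
    exact ⟨g '' uIcc s t, isCompact_uIcc.image_of_continuousOn (hg.mono hst),
      (isConnected_Icc min_le_max).image g (hg.mono hst), ⟨s, left_mem_uIcc, rfl⟩,
      ⟨t, right_mem_uIcc, rfl⟩⟩
  have hge : (∀ n : ℕ, closure (g '' (ℓ ∩ Ici (n : ℝ))) = univ) →
      ∀ U : Set X, IsOpen U → U.Nonempty → ∀ r, ∃ t ≥ r, g t ∈ U := by
    intro h U hU hne r
    obtain ⟨n, hn⟩ := exists_nat_ge r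
    obtain ⟨t, ht, htU⟩ := exists_mem_of_closure_image_eq_univ (h n) hU hne
    exact ⟨t, hn.trans ht.2, htU⟩
  have hle : (∀ n : ℕ, closure (g '' (ℓ ∩ Iic (-(n : ℝ)))) = univ) →
      ∀ U : Set X, IsOpen U → U.Nonempty → ∀ r, ∃ t ≤ r, g t ∈ U := by
    intro h U hU hne r
    obtain ⟨n, hn⟩ := exists_nat_ge (-r)
    obtain ⟨t, ht, htU⟩ := exists_mem_of_closure_image_eq_univ (h n) hU hne
    exact ⟨t, (mem_Iic.1 ht.2).trans (neg_le.1 hn), htU⟩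
  have hL : ∀ (a : ℝ) (σ : ℕ → ℝ), (∀ n, a ≠ σ n) → (∀ n, uIcc a (σ n) ⊆ ℓ) →
      closure (⋃ n, g '' uIcc a (σ n)) ≠ univ → IsCompact (closure (⋃ n, g '' uIcc a (σ n))) :=
    fun a σ hσ hsub hd => hX.isCompact_closure (s := fun _ => a) (x := g a) hσ
      (fun n => hg.mono (hsub n)) (fun n => hi.mono (hsub n)) tendsto_const_nhds hd
  have mono_ge : ∀ {m n : ℕ}, m ≤ n → closure (g '' (ℓ ∩ Ici (n : ℝ))) = univ →
      closure (g '' (ℓ ∩ Ici (m : ℝ))) = univ := fun hmn h =>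
    univ_subset_iff.1 (h ▸ closure_mono (image_mono (inter_subset_inter_right _
      (Ici_subset_Ici.2 (Nat.cast_le.2 hmn)))))
  have mono_le : ∀ {m n : ℕ}, m ≤ n → closure (g '' (ℓ ∩ Iic (-(n : ℝ)))) = univ →
      closure (g '' (ℓ ∩ Iic (-(m : ℝ)))) = univ := fun hmn h =>
    univ_subset_iff.1 (h ▸ closure_mono (image_mono (inter_subset_inter_right _
      (Iic_subset_Iic.2 (neg_le_neg (Nat.cast_le.2 hmn))))))
  by_cases hP : ∀ n : ℕ, closure (g '' (ℓ ∩ Ici (n : ℝ))) = univ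
  · rcases hℓ with hℓ | hℓ
    · refine ⟨ℓ, Subset.rfl, ∅, hℓc, isCompact_empty, by rw [hs, empty_union],
        fun U hU hne r => (hge hP U hU hne r).imp fun t ht => ⟨ht.1, fun _ => ht.2⟩,
        fun U _ _ r => ⟨min r (-1), min_le_left _ _, fun h => ?_⟩⟩
      rw [hℓ, mem_Ici] at h
      linarith [min_le_right r (-1)]
    by_cases hN : ∀ n : ℕ, closure (g '' (ℓ ∩ Iic (-(n : ℝ)))) = univ
    · exact ⟨ℓ, Subset.rfl, ∅, hℓc, isCompact_empty, by rw [hs, empty_union],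
        fun U hU hne r => (hge hP U hU hne r).imp fun t ht => ⟨ht.1, fun _ => ht.2⟩,
        fun U hU hne r => (hle hN U hU hne r).imp fun t ht => ⟨ht.1, fun _ => ht.2⟩⟩
    push Not at hN
    obtain ⟨n₀, hn₀⟩ := hN
    let a : ℝ := -(n₀ : ℝ)
    -- The half-line as an increasing union of arcs from `a`, a constant and hence convergent
    -- selection; the `- 1` keeps the arc for `n = 0` non-degenerate.
    have hun : ⋃ n : ℕ, uIcc a (a - 1 - n) = Iic a := by
      ext x
      simp only [mem_iUnion, mem_uIcc, mem_Iic]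
      refine ⟨?_, fun hx => ?_⟩
      · rintro ⟨n, h | h⟩ <;> linarith [n.cast_nonneg (α := ℝ)]
      · obtain ⟨n, hn⟩ := exists_nat_ge (a - 1 - x)
        exact ⟨n, Or.inr ⟨by linarith, hx⟩⟩
    have hLc := hL a (fun n => a - 1 - n) (fun n h => by linarith [n.cast_nonneg (α := ℝ)])
      (fun n => hℓ ▸ subset_univ _) (by
        rw [← image_iUnion, hun]
        rwa [hℓ, univ_inter] at hn₀)
    rw [← image_iUnion, hun] at hLc
    refine ⟨Ici a, hℓ ▸ subset_univ _, closure (g '' Iic a), isClosed_Ici, hLc, ?_,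
      fun U hU hne r => (hge hP U hU hne r).imp fun t ht => ⟨ht.1, fun _ => ht.2⟩,
      fun U _ _ r => ⟨min r (a - 1), min_le_left _ _, fun h => ?_⟩⟩
    · rw [← univ_subset_iff, ← hs, hℓ, ← Iic_union_Ici (a := a), image_union]
      exact union_subset_union_left _ subset_closure
    · linarith [min_le_right r (a - 1), mem_Ici.1 h]
  · push Not at hP
    obtain ⟨n₀, hn₀⟩ := hP
    -- Density of the tails is inherited by larger tails, so failure at `n₀` on the right forces
    -- density on the left for every `n`.
    have hN : ∀ n : ℕ, closure (g '' (ℓ ∩ Iic (-(n : ℝ)))) = univ := fun n =>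
      mono_le (le_max_left n n₀) ((hr (max n n₀)).resolve_left fun h =>
        hn₀ (mono_ge (le_max_right n n₀) h))
    have hℓ : ℓ = univ := hℓ.resolve_left fun hℓ => by
      obtain ⟨t, ht, -⟩ := exists_mem_of_closure_image_eq_univ (hN 1) isOpen_univ
        (univ_nonempty (α := X))
      rw [hℓ] at ht
      have h1 := mem_Ici.1 ht.1
      have h2 := mem_Iic.1 ht.2
      push_cast at h2
      linarith
    let a : ℝ := n₀
    have hun : ⋃ n : ℕ, uIcc a (a + 1 + n) = Ici a := by
      ext x
      simp only [mem_iUnion, mem_uIcc, mem_Ici]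
      refine ⟨?_, fun hx => ?_⟩
      · rintro ⟨n, h | h⟩ <;> linarith [n.cast_nonneg (α := ℝ)]
      · obtain ⟨n, hn⟩ := exists_nat_ge (x - a - 1)
        exact ⟨n, Or.inl ⟨hx, by linarith⟩⟩
    have hLc := hL a (fun n => a + 1 + n) (fun n h => by linarith [n.cast_nonneg (α := ℝ)])
      (fun n => hℓ ▸ subset_univ _) (by
        rw [← image_iUnion, hun]
        rwa [hℓ, univ_inter] at hn₀)
    rw [← image_iUnion, hun] at hLc
    refine ⟨Iic a, hℓ ▸ subset_univ _, closure (g '' Ici a), isClosed_Iic, hLc, ?_,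
      fun U _ _ r => ⟨max r (a + 1), le_max_left _ _, fun h => ?_⟩,
      fun U hU hne r => (hle hN U hU hne r).imp fun t ht => ⟨ht.1, fun _ => ht.2⟩⟩
    · rw [← univ_subset_iff, ← hs, hℓ, ← Iic_union_Ici (a := a), image_union, union_comm]
      exact union_subset_union_left _ subset_closure
    · linarith [le_max_right r (a + 1), mem_Iic.1 h]

end Parametrization

/-! ### The characterization -/

theorem mainTheorem2 (ℓ : Set ℝ) (hℓ : ℓ = Set.Ici (0 : ℝ) ∨ ℓ = Set.univ)
    (X : Type u) [TopologicalSpace X] [TopologicalSpace.MetrizableSpace X]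
    (f : ℓ → X) (hf : Continuous f) (hinj : Function.Injective f)
    (hsurj : Function.Surjective f) :
    (IsIndecomposableComposant.{u, v} X ↔ IsRecurrent f ∧ ArcClosureCondition X) ∧
      (ArcClosureCondition X ↔ ArcSubsequenceCondition X) := by
  classical
  refine ⟨?_, arcClosureCondition_iff_arcSubsequenceCondition X⟩
  have hℓ0 : Ici 0 ⊆ ℓ := by
    rcases hℓ with rfl | rfl
    exacts [Subset.rfl, subset_univ _]
  -- Extension of `f` to all reals; the value outside `ℓ` is arbitrary, because `g` is only examined
  -- on `ℓ`.
  let g : ℝ → X := fun t => if h : t ∈ ℓ then f ⟨t, h⟩ else f ⟨0, hℓ0 self_mem_Ici⟩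
  have hgf : ∀ t : ℓ, g t = f t := fun t => dif_pos t.2
  have hg : ContinuousOn g ℓ := by
    rw [continuousOn_iff_continuous_domRestrict]
    exact hf.congr fun t => (hgf t).symm
  have hi : InjOn g ℓ := fun s hs t ht hst => by
    rw [hgf ⟨s, hs⟩, hgf ⟨t, ht⟩] at hst
    exact congrArg Subtype.val (hinj hst)
  have him : ∀ A : Set ℝ, f '' {t : ℓ | (t : ℝ) ∈ A} = g '' (ℓ ∩ A) := by
    intro A
    ext x
    constructor
    · rintro ⟨t, ht, rfl⟩
      exact ⟨t, ⟨t.2, ht⟩, hgf t⟩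
    · rintro ⟨t, ht, rfl⟩
      exact ⟨⟨t, ht.1⟩, ht.2, (hgf ⟨t, ht.1⟩).symm⟩
  have hs : g '' ℓ = univ := by
    rw [← inter_univ ℓ, ← him univ]
    simpa using hsurj.range_eq
  have hrec : IsRecurrent f ↔ ∀ n : ℕ, closure (g '' (ℓ ∩ Ici (n : ℝ))) = univ ∨
      closure (g '' (ℓ ∩ Iic (-(n : ℝ)))) = univ := by
    simp only [← him]
    rfl
  rw [hrec]
  refine ⟨fun h => ⟨h.closure_image_eq_univ hℓ0 ?_ ?_ hg hi hs, h.arcClosureCondition⟩,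
    fun h => h.2.isIndecomposableComposant hℓ hg hi hs h.1⟩
  · rcases hℓ with rfl | rfl
    exacts [isClosed_Ici, isClosed_univ]
  · rcases hℓ with rfl | rfl
    exacts [ordConnected_Ici, ordConnected_univ]
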